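/- Let $\mathbb K$ be a field of characteristic $0$. Let $\mathcal{OF}$ be the vector space spanned by the ordered forests (finite sequences of planar rooted trees) with concatenation as product, and let $Lie(\mathcal{PT})\subset\mathcal{OF}$ be the space of Lie polynomials in planar rooted trees, i.e. the Lie algebra generated by the planar rooted trees under $[x,y]=xy-yx$ (the free Lie algebra on the planar trees). Left grafting $\triangleright$ on $\mathcal{OF}$ is the bilinear map for which $u\triangleright v$, for forests $u,v$, is the sum over all ways of adding, for each tree of $u$, an edge from a vertex of $v$ to the root of that tree, the new edges at a vertex being to the left of the old ones and trees of $u$ attached to the same vertex keeping their left-to-right order; it restricts to the free post-Lie structure on $Lie(\mathcal{PT})$. A Lie monomial is an iterated bracket of planar trees. Let $Lie(\mathcal{PT})_n$ be spanned by the Lie monomials with exactly $n$ vertices, labelled bijectively by $1,\dots,n$, and write $[\omega]\in Lie(\mathcal{PT})$ for the result of forgetting the labels. For $\omega\in Lie(\mathcal{PT})_n$ and labelled $\omega_1,\dots,\omega_n$, let $\omega_1\cdots\omega_n\circ\omega$ be the (post-Lie operadic) composition: write $\omega$ in terms of single vertices, $\triangleright$ and the bracket, and replace vertex $i$ by $\omega_i$,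 shifting the labels of the $\omega_i$ to consecutive blocks. The class $[\omega_1\cdots\omega_n\circ\omega]$ depends only on $[\omega_1],\dots,[\omega_n]$ and $\omega$. Let $(S(Lie(\mathcal{PT})),\centerdot)$ be the symmetric algebra of $Lie(\mathcal{PT})$. Fix any basis $\mathcal B$ of $Lie(\mathcal{PT})$ consisting of Lie monomials (such bases exist), and define $\Delta_{\mathcal Q}:S(Lie(\mathcal{PT}))\to S(Lie(\mathcal{PT}))\otimes S(Lie(\mathcal{PT}))$ as the algebra morphism with, for $\omega\in\mathcal B$, $$\Delta_{\mathcal Q}(\omega)=\sum_{n\ge1}\ \sum_{\omega_1,\dots,\omega_n\in\mathcal B}\ \sum_{\omega'}\ \frac1{n!}\,\big\langle\omega,[\omega_1\cdots\omega_n\circ\omega']\big\rangle\ \omega_1\centerdot\cdots\centerdot\omega_n\otimes[\omega'],$$ where $\omega'$ runs over the $n!$ labellings of each element of $\mathcal B$ with $n$ vertices and $\langle\omega,x\rangle$ is the coefficient of $\omega$ in the expansion of $x$ in the basis $\mathcal B$. Thus $\Delta_{\mathcal Q}$ is dual to operadic composition and is extended multiplicatively. Let $\epsilon:S(Lie(\mathcal{PT}))\to\mathbb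 K$ be the algebra morphism given on $Lie(\mathcal{PT})$ by the coefficient of the single-vertex tree $\bullet$. For a Lie monomial $\omega$ put $|\omega|=\#\{\text{vertices of }\omega\}-1$, and for $d\ge0$ let $S_d$ be the span of all products $\omega_1\centerdot\cdots\centerdot\omega_k$ ($k\ge0$) of Lie monomials with $|\omega_1|+\cdots+|\omega_k|=d$. Then: 1. The sums defining $\Delta_{\mathcal Q}(\omega)$ have only finitely many nonzero terms. On Lie monomials, $\epsilon(\bullet)=1$ and $\epsilon(\omega)=0$ for $\omega\ne\bullet$. 2. $(S(Lie(\mathcal{PT})),\Delta_{\mathcal Q},\epsilon)$ is a coassociative counital coalgebra: $(\mathrm{Id}\otimes\Delta_{\mathcal Q})\Delta_{\mathcal Q}=(\Delta_{\mathcal Q}\otimes\mathrm{Id})\Delta_{\mathcal Q}$ and $(\mathrm{Id}\otimes\epsilon)\Delta_{\mathcal Q}=\mathrm{Id}=(\epsilon\otimes\mathrm{Id})\Delta_{\mathcal Q}$. 3. Together with $\centerdot$ and its unit $1$ it is a bialgebra $\mathcal Q$: $\Delta_{\mathcal Q}$ and $\epsilon$ are multiplicative, $\Delta_{\mathcal Q}(1)=1\otimes1$,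 and $\epsilon(1)=1$. 4. If $n\ge1$, $\omega\in Lie(\mathcal{PT})_n$ and $\omega_i\in Lie(\mathcal{PT})_{k_i}$ with $k_i\ge1$ for $i=1,\dots,n$, then $[\omega_1\cdots\omega_n\circ\omega]$ is homogeneous of degree $(k_1-1)+\cdots+(k_n-1)+(n-1)$, i.e. it is a linear combination of Lie monomials of that degree; so $|[\omega_1\cdots\omega_n\circ\omega]|=|[\omega_1]|+\cdots+|[\omega_n]|+|[\omega]|$. 5. $|\cdot|$ is a grading of the bialgebra $\mathcal Q$: $S(Lie(\mathcal{PT}))=\bigoplus_{d\ge0}S_d$, $1\in S_0$, $S_c\centerdot S_d\subseteq S_{c+d}$, $\Delta_{\mathcal Q}(S_d)\subseteq\sum_{p+q=d}S_p\otimes S_q$, and $\epsilon(S_d)=0$ for $d\ne0$. -/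

import Mathlib

open scoped TensorProduct

namespace PostLie

/-! ### Planar rooted trees and ordered forests -/

/-- Planar rooted trees with vertices decorated by `α`; `node a cs` is the tree with root
decorated by `a` and with the (ordered, from left to right) list `cs` of branches.
The trees of `PTree Unit` are the plain planar rooted trees. -/
inductive PTree (α : Type) : Type
  | node : α → List (PTree α) → PTree α

variable {α β γ : Type}

mutual
/-- The list of vertex decorations of a tree. -/
def PTree.labels : PTree α → List α
  | .node a cs => a :: forestLabels cs
/-- The list of vertex decorations of an ordered forest. -/
def forestLabels : List (PTree α) → List α
  | [] => []
  | c :: cs => PTree.labels c ++ forestLabels cs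
end

mutual
/-- Change of decorations in a tree. -/
def PTree.map (f : α → β) : PTree α → PTree β
  | .node a cs => .node (f a) (forestMap f cs)
/-- Change of decorations in an ordered forest. -/
def forestMap (f : α → β) : List (PTree α) → List (PTree β)
  | [] => []
  | c :: cs => PTree.map f c :: forestMap f cs
end

/-- The single-vertex tree with its vertex decorated by `a`. -/
def bullet (a : α) : PTree α := .node a []

/-! ### Left grafting -/

/-- All ways to split a list into a sublist and the complementary sublist
(with multiplicity, i.e. one term for each subset of positions). -/
def splits {X : Type} : List X → List (List X × List X)
  | [] => [([], [])]
  | x :: xs => (splits xs).flatMap fun p => [(x :: p.1, p.2), (p.1, x :: p.2)]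

mutual
/-- `graftTree s w` lists (with multiplicity) the trees obtained from the tree `s` by adding, for
each tree of the ordered forest `w`, an edge from some vertex of `s` to the root of that tree.
The new edges at a vertex are to the left of the old ones, and trees of `w` that are grafted to the
same vertex keep their left-to-right order. -/
def graftTree : PTree α → List (PTree α) → List (PTree α)
  | .node a cs, w =>
    (splits w).flatMap fun p => (graftForest cs p.2).map fun f => .node a (p.1 ++ f)
/-- The same with an ordered forest in place of the tree `s`. -/
def graftForest : List (PTree α) → List (PTree α) → List (List (PTree α))
  | [], [] => [[]]
  | [], _ :: _ => []
  | c :: cs, w =>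
    (splits w).flatMap fun p =>
      (graftTree c p.1).flatMap fun t => (graftForest cs p.2).map fun f => t :: f
end

variable (K : Type*) [Field K]

/-- The algebra of ordered forests: the vector space spanned by all ordered forests (finite
sequences of planar trees), with concatenation as product. -/
abbrev OF (α : Type) : Type _ := MonoidAlgebra K (FreeMonoid (PTree α))

/-- The algebra of ordered forests with the commutator bracket `[x, y] = x y - y x`. -/
noncomputable instance : LieRing (OF K α) := LieRing.ofAssociativeRing

/-- An ordered forest as an element of the algebra of ordered forests. -/
noncomputable def forest (w : List (PTree α)) : OF K α := MonoidAlgebra.single (FreeMonoid.ofList w) 1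

/-- Left grafting `u ▷ v` of ordered forests, extended bilinearly: on forests, the sum of all ways
to graft the trees of `u` to vertices of `v` as described at `graftTree`. -/
noncomputable def graft : OF K α →ₗ[K] OF K α →ₗ[K] OF K α :=
  (MonoidAlgebra.basis (FreeMonoid (PTree α)) K).constr K fun w =>
    (MonoidAlgebra.basis (FreeMonoid (PTree α)) K).constr K fun v =>
      ((graftForest v.toList w.toList).map (forest K)).sum

/-- `Lie(PT)`: the Lie polynomials, that is, the Lie algebra generated by the planar trees inside
the algebra of ordered forests with the commutator bracket `[x, y] = x y - y x`. -/
noncomputable def LiePT (α : Type) : LieSubalgebra K (OF K α) :=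
  LieSubalgebra.lieSpan K (OF K α) (Set.range fun t : PTree α => forest K [t])

section closure

variable {M : Type*} [AddCommMonoid M]

/-- Sum over all splittings of a list. -/
def splitSum {X : Type} (w : List X) (F : List X → List X → M) : M :=
  ((splits w).map fun p => F p.1 p.2).sum

theorem sum_flatMap_map {X Y : Type} (l : List X) (f : X → List Y) (g : Y → M) :
    ((l.flatMap f).map g).sum = (l.map fun x => ((f x).map g).sum).sum := by
  induction l with
  | nil => simp
  | cons x l ih => simp [ih]

theorem splitSum_nil {X : Type} (F : List X → List X → M) : splitSum [] F = F [] [] := by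
  simp [splitSum, splits]

theorem splitSum_cons {X : Type} (x : X) (w : List X) (F : List X → List X → M) :
    splitSum (x :: w) F =
      splitSum w (fun a b => F (x :: a) b) + splitSum w (fun a b => F a (x :: b)) := by
  simp only [splitSum, splits]
  induction splits w with
  | nil => simp
  | cons p l ih =>
    simp only [List.flatMap_cons, List.map_append, List.sum_append, ih, List.map_cons,
      List.sum_cons, List.map_nil, List.sum_nil, add_zero]
    exact add_add_add_comm _ _ _ _

theorem splitSum_add {X : Type} (w : List X) (F G : List X → List X → M) :
    splitSum w (fun a b => F a b + G a b) = splitSum w F + splitSum w G := by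
  induction w generalizing F G with
  | nil => simp [splitSum_nil]
  | cons x w ih => rw [splitSum_cons, splitSum_cons, splitSum_cons, ih, ih]; exact add_add_add_comm _ _ _ _

theorem splitSum_swap {X : Type} (w : List X) (F : List X → List X → M) :
    splitSum w F = splitSum w (fun a b => F b a) := by
  induction w generalizing F with
  | nil => simp [splitSum_nil]
  | cons x w ih => rw [splitSum_cons, splitSum_cons, add_comm, ih, ih (fun a b => F (x :: a) b)]

theorem splitSum_assoc {X : Type} (w : List X) (F : List X → List X → List X → M) :
    splitSum w (fun a c => splitSum a fun a b => F a b c) =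
      splitSum w (fun a b => splitSum b fun b c => F a b c) := by
  induction w generalizing F with
  | nil => simp [splitSum_nil]
  | cons x w ih => simp only [splitSum_cons, splitSum_add, ih, add_assoc]

theorem mul_splitSum {R : Type*} {Y : Type} [Semiring R] (x : R) (w : List Y)
    (F : List Y → List Y → R) : x * splitSum w F = splitSum w fun a b => x * F a b :=
  (List.sum_map_mul_left _ _ _).symm

theorem splitSum_mul {R : Type*} {Y : Type} [Semiring R] (x : R) (w : List Y)
    (F : List Y → List Y → R) : splitSum w F * x = splitSum w fun a b => F a b * x :=
  (List.sum_map_mul_right _ _ _).symm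

end closure

variable {K}

theorem forest_append (v w : List (PTree α)) : forest K (v ++ w) = forest K v * forest K w := by
  simp [forest, MonoidAlgebra.single_mul_single]

theorem forest_nil : forest K ([] : List (PTree α)) = 1 := rfl

theorem basis_eq_forest (w : FreeMonoid (PTree α)) :
    MonoidAlgebra.basis (FreeMonoid (PTree α)) K w = forest K w.toList := by
  simp [forest]

theorem graft_forest (w v : List (PTree α)) :
    graft K (forest K w) (forest K v) = ((graftForest v w).map (forest K)).sum := by
  have h : ∀ w : List (PTree α),
      forest K w = MonoidAlgebra.basis (FreeMonoid (PTree α)) K (FreeMonoid.ofList w) := by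
    simp [forest]
  rw [h w, h v, graft, Module.Basis.constr_basis, Module.Basis.constr_basis]
  simp

theorem graft_nil (w : List (PTree α)) :
    graft K (forest K w) (forest K []) = if w = [] then 1 else 0 := by
  rw [graft_forest]
  cases w <;> simp [graftForest, forest_nil]

theorem graft_cons (w : List (PTree α)) (c : PTree α) (cs : List (PTree α)) :
    graft K (forest K w) (forest K (c :: cs)) = splitSum w fun a b =>
      ((graftTree c a).map fun t => forest K [t]).sum * graft K (forest K b) (forest K cs) := by
  simp only [graft_forest, graftForest, splitSum, sum_flatMap_map]
  congr 1
  refine List.map_congr_left fun p _ => ?_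
  simp only [List.map_map, Function.comp_def]
  rw [← List.sum_map_mul_right]
  congr 1
  refine List.map_congr_left fun t _ => ?_
  rw [← List.sum_map_mul_left]
  congr 1
  exact List.map_congr_left fun f _ => forest_append [t] f

theorem graft_append (w v v' : List (PTree α)) :
    graft K (forest K w) (forest K (v ++ v')) = splitSum w fun a b =>
      graft K (forest K a) (forest K v) * graft K (forest K b) (forest K v') := by
  induction v generalizing w with
  | nil =>
    simp only [List.nil_append, graft_nil]
    have : ∀ (F : List (PTree α) → OF K α) (w : List (PTree α)),
        splitSum w (fun a b => (if a = [] then 1 else 0) * F b) = F w := by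
      intro F w
      induction w generalizing F with
      | nil => simp [splitSum_nil]
      | cons x w ih =>
        rw [splitSum_cons, ih fun b => F (x :: b)]
        simp [splitSum]
    exact (this (fun b => graft K (forest K b) (forest K v')) w).symm
  | cons c cs ih =>
    simp only [List.cons_append, graft_cons, ih]
    simp only [splitSum_mul, mul_splitSum]
    simp only [← mul_assoc]
    rw [splitSum_assoc w fun a b c' => ((graftTree c a).map fun t => forest K [t]).sum *
      graft K (forest K b) (forest K cs) * graft K (forest K c') (forest K v')]

theorem forest_induction {p : OF K α → Prop} (h0 : p 0) (hf : ∀ w, p (forest K w))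
    (ha : ∀ x y, p x → p y → p (x + y)) (hs : ∀ (c : K) x, p x → p (c • x)) (x : OF K α) : p x := by
  have hx := (MonoidAlgebra.basis (FreeMonoid (PTree α)) K).mem_span x
  induction hx using Submodule.span_induction with
  | mem x h => obtain ⟨w, rfl⟩ := h; rw [basis_eq_forest]; exact hf _
  | zero => exact h0
  | add x y _ _ hx hy => exact ha x y hx hy
  | smul c x _ hx => exact hs c x hx

theorem graft_mul (w : List (PTree α)) (x y : OF K α) :
    graft K (forest K w) (x * y) = splitSum w fun a b =>
      graft K (forest K a) x * graft K (forest K b) y := by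
  induction x using forest_induction with
  | h0 => simp [splitSum]
  | ha x x' hx hx' => simp [add_mul, hx, hx', splitSum_add]
  | hs c x hx => simp [hx, splitSum, List.smul_sum, Function.comp_def]
  | hf v =>
    induction y using forest_induction with
    | h0 => simp [splitSum]
    | ha x x' hx hx' => simp [mul_add, hx, hx', splitSum_add]
    | hs c x hx => simp [hx, splitSum, List.smul_sum, Function.comp_def]
    | hf v' => rw [← forest_append, graft_append]

theorem tree_mem (t : PTree α) : forest K [t] ∈ LiePT K α :=
  LieSubalgebra.subset_lieSpan ⟨t, rfl⟩

theorem splitSum_mem (S : Submodule K (OF K α)) (w : List (PTree α))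
    (F : List (PTree α) → List (PTree α) → OF K α) (h : ∀ a b, F a b ∈ S) : splitSum w F ∈ S :=
  list_sum_mem fun x hx => by
    obtain ⟨p, -, rfl⟩ := List.mem_map.1 hx
    exact h _ _

/-- Grafting any ordered forests onto a Lie polynomial gives a Lie polynomial. -/
theorem graft_mem (u : OF K α) {z : OF K α} (hz : z ∈ LiePT K α) : graft K u z ∈ LiePT K α := by
  induction u using forest_induction with
  | h0 => simp
  | ha x y hx hy => simpa using add_mem hx hy
  | hs c x hx => simpa using (LiePT K α).smul_mem c hx
  | hf w =>
    induction hz using LieSubalgebra.lieSpan_induction generalizing w with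
    | mem x h =>
      obtain ⟨t, rfl⟩ := h
      rw [graft_cons]
      refine splitSum_mem (LiePT K α).toSubmodule _ _ fun a b => ?_
      rw [graft_nil]
      split_ifs
      · rw [mul_one]
        refine list_sum_mem fun x hx => ?_
        obtain ⟨t', -, rfl⟩ := List.mem_map.1 hx
        exact tree_mem t'
      · simp
    | zero => simp
    | add x y _ _ hx hy => simpa using add_mem (hx w) (hy w)
    | smul c x _ hx => simpa using (LiePT K α).smul_mem c (hx w)
    | lie x y _ _ hx hy =>
      rw [LieRing.of_associative_ring_bracket, map_sub, graft_mul, graft_mul,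
        splitSum_swap w fun a b => graft K (forest K a) y * graft K (forest K b) x]
      have : ∀ F G : List (PTree α) → List (PTree α) → OF K α,
          splitSum w F - splitSum w G = splitSum w fun a b => F a b - G a b := by
        intro F G
        rw [sub_eq_iff_eq_add, ← splitSum_add]
        simp
      rw [this]
      exact splitSum_mem (LiePT K α).toSubmodule _ _ fun a b =>
        (LiePT K α).lie_mem (hx a) (hy b)

/-! ### Substitution (operadic composition) -/

variable (K)

mutual
/-- Substitution of elements `x a` for the vertices decorated by `a` in a planar tree. Since the
tree `node a cs` is `(c₁ ⋯ cₖ) ▷ a`, it is sent to `(c₁' ⋯ cₖ') ▷ x a`, where `cᵢ'` is the result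
of the substitution in the branch `cᵢ`. -/
noncomputable def substTree (x : α → OF K β) : PTree α → OF K β
  | .node a cs => graft K (substForest x cs) (x a)
/-- Substitution in an ordered forest: the product of the substitutions in its trees. -/
noncomputable def substForest (x : α → OF K β) : List (PTree α) → OF K β
  | [] => 1
  | c :: cs => substTree x c * substForest x cs
end

/-- Substitution as an algebra morphism of ordered forests. -/
noncomputable def subst (x : α → OF K β) : OF K α →ₐ[K] OF K β :=
  MonoidAlgebra.lift K (OF K β) (FreeMonoid (PTree α)) (FreeMonoid.lift (substTree K x))

variable {K}

theorem mem_of_algHom (f : OF K α →ₐ[K] OF K β) (hf : ∀ t, f (forest K [t]) ∈ LiePT K β)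
    {z : OF K α} (hz : z ∈ LiePT K α) : f z ∈ LiePT K β := by
  induction hz using LieSubalgebra.lieSpan_induction with
  | mem x h => obtain ⟨t, rfl⟩ := h; exact hf t
  | zero => simp
  | add x y _ _ hx hy => simpa using add_mem hx hy
  | smul c x _ hx => simpa using (LiePT K β).smul_mem c hx
  | lie x y _ _ hx hy =>
    rw [LieRing.of_associative_ring_bracket, map_sub, map_mul, map_mul,
      ← LieRing.of_associative_ring_bracket]
    exact (LiePT K β).lie_mem hx hy

theorem subst_tree (x : α → OF K β) (t : PTree α) : subst K x (forest K [t]) = substTree K x t := by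
  have h : FreeMonoid.ofList [t] = FreeMonoid.of t := rfl
  rw [subst, forest, MonoidAlgebra.lift_single, one_smul, h, FreeMonoid.lift_eval_of]

theorem subst_mem (x : α → LiePT K β) {z : OF K α} (hz : z ∈ LiePT K α) :
    subst K (fun a => (x a : OF K β)) z ∈ LiePT K β :=
  mem_of_algHom _ (fun t => by
    rw [subst_tree]; cases t; rw [substTree]; exact graft_mem _ (x _).2) hz

variable (K)

/-- Substitution of Lie polynomials `x a` for the vertices decorated by `a` in Lie polynomials: the
bracket and the grafting are kept, and the single-vertex tree decorated by `a` becomes `x a`. -/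
noncomputable def substLie (x : α → LiePT K β) : LiePT K α →ₗ[K] LiePT K β :=
  (subst K fun a => (x a : OF K β)).toLinearMap.restrict fun _ hz => subst_mem x hz

/-- Change of decorations for Lie polynomials. -/
noncomputable def relabel (f : α → β) : LiePT K α →ₗ[K] LiePT K β :=
  (MonoidAlgebra.mapDomainAlgHom K K (FreeMonoid.map (PTree.map f))).toLinearMap.restrict
    fun _ hz => mem_of_algHom _ (fun t => by
      have h : MonoidAlgebra.mapDomainAlgHom K K (FreeMonoid.map (PTree.map f)) (forest K [t]) =
          forest K [PTree.map f t] := by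
        simp [forest]
      rw [h]; exact tree_mem _) hz

/-- Forget the labels of a Lie polynomial, `ω ↦ [ω]`. -/
noncomputable abbrev unlabel : LiePT K α →ₗ[K] LiePT K Unit := relabel K fun _ => ()

/-- Operadic composition `ω₁ ⋯ ωₙ ∘ ω` of Lie polynomials in labelled trees: `ωᵢ` is substituted
for the vertex `i` of `ω`, and the labels of the `ωᵢ` are shifted to consecutive blocks. -/
noncomputable def operadComp {n : ℕ} {k : Fin n → ℕ} (x : ∀ a, LiePT K (Fin (k a)))
    (y : LiePT K (Fin n)) : LiePT K (Fin (∑ a, k a)) :=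
  substLie K (fun a => relabel K (fun c => finSigmaFinEquiv ⟨a, c⟩) (x a)) y

variable {K}

theorem forestMap_eq (f : α → β) (w : List (PTree α)) : forestMap f w = w.map (PTree.map f) := by
  induction w with
  | nil => rfl
  | cons c w ih => simp [forestMap, ih]

theorem splits_map {X Y : Type} (f : X → Y) (w : List X) :
    splits (w.map f) = (splits w).map fun p => (p.1.map f, p.2.map f) := by
  induction w with
  | nil => rfl
  | cons x w ih => simp [splits, ih, List.flatMap_map, List.map_flatMap]

mutual
theorem graftTree_map (f : α → β) : ∀ (s : PTree α) (w : List (PTree α)),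
    graftTree (s.map f) (w.map (PTree.map f)) = (graftTree s w).map (PTree.map f)
  | .node a cs, w => by
    simp only [PTree.map, graftTree, splits_map, List.flatMap_map, List.map_flatMap,
      graftForest_map f cs, List.map_map, Function.comp_def, forestMap_eq f (_ ++ _),
      List.map_append]
    simp only [forestMap_eq]
theorem graftForest_map (f : α → β) : ∀ (cs : List (PTree α)) (w : List (PTree α)),
    graftForest (forestMap f cs) (w.map (PTree.map f)) = (graftForest cs w).map (forestMap f)
  | [], [] => rfl
  | [], _ :: _ => rfl
  | c :: cs, w => by
    simp only [forestMap, graftForest, splits_map, List.flatMap_map, List.map_flatMap,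
      graftTree_map f c, graftForest_map f cs, List.map_map, Function.comp_def]
end

/-- Change of decorations for ordered forests. -/
noncomputable abbrev relabelOF (f : α → β) : OF K α →ₐ[K] OF K β :=
  MonoidAlgebra.mapDomainAlgHom K K (FreeMonoid.map (PTree.map f))

theorem relabelOF_forest (f : α → β) (w : List (PTree α)) :
    relabelOF (K := K) f (forest K w) = forest K (forestMap f w) := by
  simp [forest, forestMap_eq]; rfl

theorem relabelOF_graft (f : α → β) (u v : OF K α) :
    relabelOF f (graft K u v) = graft K (relabelOF f u) (relabelOF f v) := by
  induction u using forest_induction with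
  | h0 => simp
  | ha x y hx hy => simp only [map_add, LinearMap.add_apply, hx, hy]
  | hs c x hx => simp only [map_smul, LinearMap.smul_apply, hx]
  | hf w =>
    induction v using forest_induction with
    | h0 => simp
    | ha x y hx hy => simp only [map_add, hx, hy]
    | hs c x hx => simp only [map_smul, hx]
    | hf v =>
      simp only [relabelOF_forest, graft_forest]
      rw [forestMap_eq f w, graftForest_map, map_list_sum]
      simp only [List.map_map, Function.comp_def, relabelOF_forest]

mutual
theorem relabelOF_substTree (f : β → γ) (x : α → OF K β) : ∀ t : PTree α,
    relabelOF f (substTree K x t) = substTree K (fun a => relabelOF f (x a)) t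
  | .node a cs => by
    rw [substTree, substTree, relabelOF_graft, relabelOF_substForest f x cs]
theorem relabelOF_substForest (f : β → γ) (x : α → OF K β) : ∀ t : List (PTree α),
    relabelOF f (substForest K x t) = substForest K (fun a => relabelOF f (x a)) t
  | [] => by simp [substForest]
  | c :: cs => by
    rw [substForest, substForest, map_mul, relabelOF_substForest f x cs, relabelOF_substTree f x c]
end

theorem OF_algHom_ext {g h : OF K α →ₐ[K] OF K β} (H : ∀ t, g (forest K [t]) = h (forest K [t])) :
    g = h :=
  (MonoidAlgebra.lift K (OF K β) (FreeMonoid (PTree α))).symm.injective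
    (FreeMonoid.hom_eq fun t => H t)

theorem relabel_substLie (f : β → γ) (x : α → LiePT K β) (y : LiePT K α) :
    relabel K f (substLie K x y) = substLie K (fun a => relabel K f (x a)) y := by
  have h : (relabelOF f).comp (subst K fun a => (x a : OF K β)) =
      subst K (fun a => relabelOF f (x a : OF K β)) := OF_algHom_ext fun t => by
    rw [AlgHom.comp_apply, subst_tree, subst_tree, relabelOF_substTree]
  exact Subtype.ext (congrArg (fun g => g (y : OF K α)) h)

mutual
theorem PTree.map_map (f : α → β) (g : β → γ) : ∀ t : PTree α,
    (t.map f).map g = t.map fun a => g (f a)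
  | .node a cs => by rw [PTree.map, PTree.map, PTree.map, forestMap_map f g cs]
theorem forestMap_map (f : α → β) (g : β → γ) : ∀ w : List (PTree α),
    forestMap g (forestMap f w) = forestMap (fun a => g (f a)) w
  | [] => rfl
  | c :: cs => by rw [forestMap, forestMap, forestMap, forestMap_map f g cs, PTree.map_map f g c]
end

theorem relabel_relabel (f : α → β) (g : β → γ) (x : LiePT K α) :
    relabel K g (relabel K f x) = relabel K (fun a => g (f a)) x := by
  have h : (relabelOF (K := K) g).comp (relabelOF f) = relabelOF fun a => g (f a) :=
    OF_algHom_ext fun t => by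
      rw [AlgHom.comp_apply, relabelOF_forest, relabelOF_forest, relabelOF_forest, forestMap_map]
  exact Subtype.ext (congrArg (fun g => g (x : OF K α)) h)

/-- The unlabelled composite `[ω₁ ⋯ ωₙ ∘ ω]` only depends on `[ω₁], …, [ωₙ]` and `ω`: it is
obtained by substituting the `[ωᵢ]` for the vertices of `ω`. -/
theorem unlabel_operadComp {n : ℕ} {k : Fin n → ℕ} (x : ∀ a, LiePT K (Fin (k a)))
    (y : LiePT K (Fin n)) :
    unlabel K (operadComp K x y) = substLie K (fun a => unlabel K (x a)) y := by
  rw [operadComp, unlabel, relabel_substLie]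
  simp only [relabel_relabel]

variable (K)

/-! ### Lie monomials and labellings -/

/-- Evaluation of a Lie monomial, i.e. of a formal bracketing of planar trees. -/
noncomputable def lieEval : FreeMagma (PTree α) → LiePT K α
  | .of t => ⟨forest K [t], tree_mem t⟩
  | .mul u v => ⁅lieEval u, lieEval v⁆

/-- The list of the decorations of all vertices in a Lie monomial. -/
def monLabels : FreeMagma (PTree α) → List α
  | .of t => t.labels
  | .mul u v => monLabels u ++ monLabels v

/-- The number of vertices in a Lie monomial; it is at least one. -/
def numVertices (w : FreeMagma (PTree α)) : ℕ := (monLabels w).length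

/-- The degree `|ω| = #{vertices in ω} - 1` of a Lie monomial. -/
def monDegree (w : FreeMagma (PTree α)) : ℕ := numVertices w - 1

/-- A Lie monomial in which each label `0, …, n - 1` occurs at exactly one vertex. -/
def IsLabelled {n : ℕ} (w : FreeMagma (PTree (Fin n))) : Prop :=
  (monLabels w).Perm (List.finRange n)

/-- `Lie(PT)ₙ`: the space spanned by the Lie monomials with exactly `n` vertices, together with a
bijective labelling of the vertices. -/
noncomputable def LabelledLie (n : ℕ) : Submodule K (LiePT K (Fin n)) :=
  Submodule.span K {x | ∃ w, IsLabelled w ∧ x = lieEval K w}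

/-- The labellings of an unlabelled Lie monomial; there are `n!` of them if it has `n` vertices. -/
abbrev Labelling (m : FreeMagma (PTree Unit)) : Type :=
  {w : FreeMagma (PTree (Fin (numVertices m))) //
    IsLabelled w ∧ FreeMagma.map (PTree.map fun _ => ()) w = m}

/-- A basis of `Lie(PT)` that consists of Lie monomials. -/
structure LieBasis (ι : Type*) where
  mon : ι → FreeMagma (PTree Unit)
  basis : Module.Basis ι K (LiePT K Unit)
  basis_eq : ∀ i, basis i = lieEval K (mon i)

variable {K}

theorem span_lieEval : Submodule.span K (Set.range (lieEval K (α := α))) = ⊤ := by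
  set S := Submodule.span K (Set.range (lieEval K (α := α))) with hS
  have hlie : ∀ x y, x ∈ S → y ∈ S → ⁅x, y⁆ ∈ S := by
    intro x y hx hy
    induction hx using Submodule.span_induction with
    | zero => simp
    | add x x' _ _ hx hx' => simpa using add_mem hx hx'
    | smul c x _ hx => simpa using S.smul_mem c hx
    | mem x h =>
      obtain ⟨u, rfl⟩ := h
      induction hy using Submodule.span_induction with
      | zero => simp
      | add x x' _ _ hx hx' => simpa using add_mem hx hx'
      | smul c x _ hx => simpa using S.smul_mem c hx
      | mem y h => obtain ⟨v, rfl⟩ := h; exact Submodule.subset_span ⟨.mul u v, rfl⟩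
  have key : ∀ z (hz : z ∈ LiePT K α), (⟨z, hz⟩ : LiePT K α) ∈ S := fun z hz => by
    induction hz using LieSubalgebra.lieSpan_induction with
    | mem x h => obtain ⟨t, rfl⟩ := h; exact Submodule.subset_span ⟨.of t, rfl⟩
    | zero => exact S.zero_mem
    | add x y h h' hx hy => exact S.add_mem hx hy
    | smul c x h hx => exact S.smul_mem c hx
    | lie x y h h' hx hy => exact hlie ⟨x, h⟩ ⟨y, h'⟩ hx hy
  exact eq_top_iff.2 fun z _ => key z.1 z.2

variable (K) in
/-- Bases of `Lie(PT)` that consist of Lie monomials exist. -/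
theorem exists_lieBasis : ∃ s : Set (LiePT K Unit), Nonempty (LieBasis K s) := by
  obtain ⟨s, hs, hspan, hli⟩ :=
    exists_linearIndependent K (Set.range (lieEval K (α := Unit)))
  choose m hm using fun i : s => hs i.2
  refine ⟨s, ⟨⟨m, Module.Basis.mk hli ?_, fun i => ?_⟩⟩⟩
  · rw [Subtype.range_coe, hspan, span_lieEval]
  · rw [Module.Basis.mk_apply, hm]

variable (K)

/-! ### The bialgebra -/

/-- The symmetric algebra `S(Lie(PT))`. -/
abbrev SLie : Type _ := SymmetricAlgebra K (LiePT K Unit)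

variable {K} {ι : Type*}

namespace LieBasis

/-- The index set of the coproduct: a basis monomial `ω'`, a labelling of its vertices by
`1, …, n`, and basis monomials `ω₁, …, ωₙ`. -/
abbrev Term (b : LieBasis K ι) : Type _ :=
  (i : ι) × Labelling (b.mon i) × (Fin (numVertices (b.mon i)) → ι)

/-- The element `[ω₁ ⋯ ωₙ ∘ ω']` of `Lie(PT)` (see `unlabel_operadComp`). -/
noncomputable def comp (b : LieBasis K ι) (c : b.Term) : LiePT K Unit :=
  substLie K (fun a => b.basis (c.2.2 a)) (lieEval K c.2.1.1)

/-- `1 / n!` times the coefficient of the `i`-th basis monomial in `[ω₁ ⋯ ωₙ ∘ ω']`. -/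
noncomputable def coeff (b : LieBasis K ι) (i : ι) (c : b.Term) : K :=
  ((numVertices (b.mon c.1)).factorial : K)⁻¹ * b.basis.repr (b.comp c) i

/-- The coproduct of the `i`-th basis monomial: the sum, over all basis monomials `ω'`, all their
labellings and all basis monomials `ω₁, …, ωₙ`, of the coefficient of this monomial in
`[ω₁ ⋯ ωₙ ∘ ω']` times `1 / n!` times `ω₁ ⬝ ⋯ ⬝ ωₙ ⊗ ω'`. -/
noncomputable def coprodBasis (b : LieBasis K ι) (i : ι) : SLie K ⊗[K] SLie K :=
  ∑ᶠ c : b.Term, b.coeff i c •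
    ((∏ a, SymmetricAlgebra.ι K (LiePT K Unit) (b.basis (c.2.2 a))) ⊗ₜ[K]
      SymmetricAlgebra.ι K (LiePT K Unit) (b.basis c.1))

/-- The coproduct, extended linearly to `Lie(PT)` and multiplicatively to `S(Lie(PT))`. -/
noncomputable def coprod (b : LieBasis K ι) : SLie K →ₐ[K] SLie K ⊗[K] SLie K :=
  SymmetricAlgebra.lift (b.basis.constr K b.coprodBasis)

end LieBasis

variable (K)

/-- The linear form on `Lie(PT)` that gives the coefficient of the single-vertex tree; it is `1` on
the single-vertex tree and `0` on all other Lie monomials. -/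
noncomputable def bulletCoeff : LiePT K Unit →ₗ[K] K :=
  (MonoidAlgebra.basis (FreeMonoid (PTree Unit)) K).coord (FreeMonoid.ofList [bullet ()]) ∘ₗ
    (LiePT K Unit).toSubmodule.subtype

/-- The counit: the multiplicative extension of `bulletCoeff`. -/
noncomputable def counit : SLie K →ₐ[K] K := SymmetricAlgebra.lift (bulletCoeff K)

/-- The elements of degree `d` in `Lie(PT)`: the span of the Lie monomials of degree `d`. -/
noncomputable def lieGrade (d : ℕ) : Submodule K (LiePT K Unit) :=
  Submodule.span K {x | ∃ w, monDegree w = d ∧ x = lieEval K w}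

/-- The elements of degree `d` in `S(Lie(PT))`: the span of the products `ω₁ ⬝ ⋯ ⬝ ωₙ` of Lie
monomials with `|ω₁| + ⋯ + |ωₙ| = d`. -/
noncomputable def symGrade (d : ℕ) : Submodule K (SLie K) :=
  Submodule.span K {x | ∃ l : List (FreeMagma (PTree Unit)), (l.map monDegree).sum = d ∧
    x = (l.map fun w => SymmetricAlgebra.ι K (LiePT K Unit) (lieEval K w)).prod}

/-- The elements of degree `d` in `S(Lie(PT)) ⊗ S(Lie(PT))`. -/
noncomputable def tensorGrade (d : ℕ) : Submodule K (SLie K ⊗[K] SLie K) :=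
  ⨆ p ∈ Finset.HasAntidiagonal.antidiagonal d,
    LinearMap.range (TensorProduct.map (symGrade K p.1).subtype (symGrade K p.2).subtype)

end PostLie

/-!
The coproduct is dual to substitution. A Lie polynomial `φ` gives a character of the symmetric
algebra `S(Lie(PT))`, namely the one that maps a basis monomial to its coefficient in `φ`, and
`LieBasis.productMap_comp_coprod` says that the convolution of the characters of `φ` and `ψ` along
the coproduct is the character of the Lie polynomial obtained by substituting `φ` for all vertices
of `ψ`. In its proof each of the `n!` labellings of a basis monomial with `n` vertices
(`card_labelling`) contributes the same, which cancels the factor `1 / n!`, and substitution into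
a labelled monomial is multilinear (`substMultilinear`).

Since `K` is infinite, an element of `S(Lie(PT))`, which is a polynomial in finitely many basis
monomials, vanishes if all these characters do so on it (`LieBasis.eq_zero_of_character`), and the
same follows for tensor powers. No completion is needed. Coassociativity thus becomes the
associativity of substitution (`substLie_substLie`), and as the counit is the character of the
single-vertex tree `•` (`LieBasis.character_bullet`), counitality says that substitution of `φ`
into `•` gives `φ` and that substitution of `•` into `ψ` gives `ψ`.

Substitution is associative because it commutes with grafting (`subst_graft`). This rests on the
D-algebra structure of ordered forests: a Lie polynomial `z` is primitive for the deshuffling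
coproduct, hence `z ▷ -` is a derivation (`graft_lie_mul`), and
`z ▷ (v ▷ w) = (z v + z ▷ v) ▷ w` (`graft_lie_graft`). The latter is proved by induction on trees, where
`node a cs` is `cs ▷ •` (`graft_bullet`).

Homogeneity is expressed by eigenvalues. Substituting `2 •` for each vertex multiplies a Lie
monomial with `n` vertices by `2 ^ n`, and these numbers are distinct in characteristic zero, so
that the eigenvectors for `2 ^ n` are the homogeneous elements (`LieBasis.mem_lieGrade`). As this
operator is itself a substitution, its eigenvalues are multiplicative under composition
(`dilation_substLie`). This gives the degree formula, the finiteness of the sums (a homogeneous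
component involves finitely many monomials), the directness of the sum of the graded pieces of
`S(Lie(PT))`, and the compatibility of the coproduct with the grading.
-/

namespace PostLie

/-! ### The deshuffling coproduct and grafting -/

section Grafting

variable {K : Type*} [Field K] {α β : Type}

/-- The deshuffling coproduct of ordered forests: the algebra morphism for which planar trees
are primitive. -/
noncomputable def deshuffle (K : Type*) [Field K] (α : Type) : OF K α →ₐ[K] OF K α ⊗[K] OF K α :=
  MonoidAlgebra.lift K _ (FreeMonoid (PTree α))
    (FreeMonoid.lift fun t => forest K [t] ⊗ₜ 1 + 1 ⊗ₜ forest K [t])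

theorem deshuffle_tree (t : PTree α) :
    deshuffle K α (forest K [t]) = forest K [t] ⊗ₜ 1 + 1 ⊗ₜ forest K [t] := by
  have h : FreeMonoid.ofList [t] = FreeMonoid.of t := rfl
  rw [deshuffle, forest, MonoidAlgebra.lift_single, one_smul, h, FreeMonoid.lift_eval_of]
  rfl

theorem forest_cons (t : PTree α) (w : List (PTree α)) :
    forest K (t :: w) = forest K [t] * forest K w := forest_append [t] w

theorem deshuffle_forest (w : List (PTree α)) :
    deshuffle K α (forest K w) = splitSum w fun a b => forest K a ⊗ₜ[K] forest K b := by
  induction w with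
  | nil => simp [splitSum_nil, forest_nil, Algebra.TensorProduct.one_def]
  | cons t w ih =>
    rw [forest_cons, map_mul, ih, deshuffle_tree, splitSum_cons, add_mul, mul_splitSum,
      mul_splitSum]
    simp only [Algebra.TensorProduct.tmul_mul_tmul, one_mul, ← forest_cons]

theorem deshuffle_of_mem {z : OF K α} (hz : z ∈ LiePT K α) :
    deshuffle K α z = z ⊗ₜ 1 + 1 ⊗ₜ z := by
  induction hz using LieSubalgebra.lieSpan_induction with
  | mem x h => obtain ⟨t, rfl⟩ := h; exact deshuffle_tree t
  | zero => simp
  | add x y _ _ hx hy => rw [map_add, hx, hy, TensorProduct.add_tmul, TensorProduct.tmul_add]; abel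
  | smul c x _ hx => rw [map_smul, hx, smul_add, TensorProduct.smul_tmul', TensorProduct.tmul_smul]
  | lie x y _ _ hx hy =>
    rw [LieRing.of_associative_ring_bracket, map_sub, map_mul, map_mul, hx, hy]
    simp only [mul_add, add_mul, Algebra.TensorProduct.tmul_mul_tmul, one_mul, mul_one,
      TensorProduct.sub_tmul, TensorProduct.tmul_sub]
    abel

/-- The product of the two factors, after grafting the first one onto `x` and the second one
onto `y`. -/
noncomputable def graftBoth (x y : OF K α) : OF K α ⊗[K] OF K α →ₗ[K] OF K α :=
  LinearMap.mul' K (OF K α) ∘ₗ TensorProduct.map ((graft K).flip x) ((graft K).flip y)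

/-- The product of the two factors, after grafting the second one onto `y`. Applied to the
coproduct of `u`, this is the Grossman-Larson product of `u` and `y`. -/
noncomputable def graftRight (y : OF K α) : OF K α ⊗[K] OF K α →ₗ[K] OF K α :=
  LinearMap.mul' K (OF K α) ∘ₗ TensorProduct.map LinearMap.id ((graft K).flip y)

@[simp]
theorem graftBoth_tmul (x y p q : OF K α) :
    graftBoth x y (p ⊗ₜ q) = graft K p x * graft K q y := rfl

@[simp]
theorem graftRight_tmul (y p q : OF K α) : graftRight y (p ⊗ₜ q) = p * graft K q y := rfl

theorem map_splitSum {X : Type} {M N F : Type*} [AddCommMonoid M] [AddCommMonoid N]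
    [FunLike F M N] [AddMonoidHomClass F M N] (g : F) (w : List X) (G : List X → List X → M) :
    g (splitSum w G) = splitSum w fun a b => g (G a b) := by
  simp [splitSum, map_list_sum, Function.comp_def]

/-- Grafting onto a product is governed by the coproduct of the grafted element. -/
theorem graft_mul_eq (u x y : OF K α) :
    graft K u (x * y) = graftBoth x y (deshuffle K α u) := by
  induction u using forest_induction with
  | h0 => simp
  | ha u v hu hv => simp [hu, hv]
  | hs c u hu => simp [hu]
  | hf w => rw [graft_mul, deshuffle_forest, map_splitSum]; simp

mutual
theorem graftTree_nil : ∀ t : PTree α, graftTree t [] = [t]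
  | .node a cs => by simp [graftTree, splits, graftForest_nil cs]
theorem graftForest_nil : ∀ cs : List (PTree α), graftForest cs [] = [cs]
  | [] => rfl
  | c :: cs => by simp [graftForest, splits, graftTree_nil c, graftForest_nil cs]
end

theorem graft_one (x : OF K α) : graft K 1 x = x := by
  induction x using forest_induction with
  | h0 => simp
  | ha u v hu hv => simp [hu, hv]
  | hs c u hu => simp [hu]
  | hf w => rw [← forest_nil, graft_forest, graftForest_nil]; simp

/-- Grafting a Lie polynomial is a derivation, because Lie polynomials are primitive. -/
theorem graft_lie_mul {z : OF K α} (hz : z ∈ LiePT K α) (x y : OF K α) :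
    graft K z (x * y) = graft K z x * y + x * graft K z y := by
  rw [graft_mul_eq, deshuffle_of_mem hz]
  simp [graft_one]

theorem graft_lie_one {z : OF K α} (hz : z ∈ LiePT K α) : graft K z 1 = 0 := by
  have h := graft_lie_mul hz 1 1
  simpa using h

/-- The augmentation of the algebra of ordered forests: the constant coefficient. -/
noncomputable def augmentation (K : Type*) [Field K] (α : Type) : OF K α →ₐ[K] K :=
  MonoidAlgebra.lift K _ (FreeMonoid (PTree α)) (FreeMonoid.lift fun _ => 0)

theorem augmentation_tree (t : PTree α) : augmentation K α (forest K [t]) = 0 := by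
  have h : FreeMonoid.ofList [t] = FreeMonoid.of t := rfl
  rw [augmentation, forest, MonoidAlgebra.lift_single, one_smul, h, FreeMonoid.lift_eval_of]

theorem augmentation_of_mem {z : OF K α} (hz : z ∈ LiePT K α) : augmentation K α z = 0 := by
  induction hz using LieSubalgebra.lieSpan_induction with
  | mem x h => obtain ⟨t, rfl⟩ := h; exact augmentation_tree t
  | zero => simp
  | add x y _ _ hx hy => simp [hx, hy]
  | smul c x _ hx => simp [hx]
  | lie x y _ _ hx hy => simp [LieRing.of_associative_ring_bracket, hx]

theorem graft_right_one (u : OF K α) : graft K u 1 = augmentation K α u • (1 : OF K α) := by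
  induction u using forest_induction with
  | h0 => simp
  | ha u v hu hv => simp [hu, hv, add_smul]
  | hs c u hu => simp [hu, mul_smul]
  | hf w =>
    rw [← forest_nil, graft_nil]
    cases w with
    | nil => simp [forest_nil]
    | cons t w => rw [forest_cons, map_mul, augmentation_tree]; simp

theorem augmentation_graft_lie {z : OF K α} (hz : z ∈ LiePT K α) (u : OF K α) :
    augmentation K α (graft K z u) = 0 := by
  induction u using forest_induction with
  | h0 => simp
  | ha u v hu hv => simp [hu, hv]
  | hs c u hu => simp [hu]
  | hf w =>
    cases w with
    | nil => rw [forest_nil, graft_lie_one hz, map_zero]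
    | cons t w =>
      rw [forest_cons, graft_lie_mul hz, map_add, map_mul, map_mul, augmentation_tree,
        augmentation_of_mem (graft_mem z (tree_mem t))]
      simp

theorem splitSum_eq_nil {X : Type} {M : Type*} [AddCommMonoid M] (w : List X)
    (G : List X → List X → M) (h : ∀ a b, b ≠ [] → G a b = 0) : splitSum w G = G w [] := by
  induction w generalizing G with
  | nil => simp [splitSum_nil]
  | cons x w ih =>
    rw [splitSum_cons, ih (fun a b => G (x :: a) b) fun a b hb => h _ _ hb]
    simp [splitSum, h]

theorem graft_tree (w : List (PTree α)) (t : PTree α) :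
    graft K (forest K w) (forest K [t]) = ((graftTree t w).map fun s => forest K [s]).sum := by
  rw [graft_cons, splitSum_eq_nil]
  · simp [graft_nil]
  · intro a b hb; simp [graft_nil, hb]

theorem graft_bullet (w : List (PTree α)) (a : α) :
    graft K (forest K w) (forest K [bullet a]) = forest K [.node a w] := by
  rw [graft_tree, bullet, graftTree, sum_flatMap_map]
  refine (splitSum_eq_nil w (fun p q => (((graftForest [] q).map fun f => PTree.node a (p ++ f)).map
    fun s => forest K [s]).sum) fun p q hq => ?_).trans ?_
  · cases q <;> simp_all [graftForest]
  · simp [graftForest]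

/-- Grafting onto a tree whose branches form the forest `y`: the new trees are either branches
at the root or are grafted onto the old branches. -/
theorem graft_graft_bullet (u y : OF K α) (a : α) :
    graft K u (graft K y (forest K [bullet a])) =
      graft K (graftRight y (deshuffle K α u)) (forest K [bullet a]) := by
  induction y using forest_induction with
  | h0 =>
    have : graftRight (0 : OF K α) = 0 := by ext; simp
    simp [this]
  | ha y y' hy hy' =>
    have : graftRight (y + y') = graftRight y + graftRight y' := by ext; simp [mul_add]
    simp [this, hy, hy']
  | hs c y hy =>
    have : graftRight (c • y) = c • graftRight y := by ext; simp
    simp [this, hy]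
  | hf cs =>
  induction u using forest_induction with
  | h0 => simp
  | ha u v hu hv => simp [hu, hv]
  | hs c u hu => simp [hu]
  | hf w =>
    rw [graft_bullet, graft_tree, graftTree, sum_flatMap_map, deshuffle_forest, map_splitSum,
      ← LinearMap.flip_apply, map_splitSum, splitSum]
    congr 1
    refine List.map_congr_left fun p _ => ?_
    rw [graftRight_tmul, graft_forest, ← List.sum_map_mul_left, map_list_sum]
    simp only [List.map_map, Function.comp_def, LinearMap.flip_apply, ← forest_append,
      graft_bullet]

/-- Induction on the number of vertices, for linear statements about ordered forests: a tree is
reduced to the forest of its branches, which is grafted onto a single vertex. -/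
theorem tree_forest_induction {p : OF K α → Prop} (h1 : p 1)
    (hm : ∀ (t : PTree α) (x : OF K α), p (forest K [t]) → p x → p (forest K [t] * x))
    (hb : ∀ (a : α) (w : List (PTree α)), p (forest K w) →
      p (graft K (forest K w) (forest K [bullet a])))
    (h0 : p 0) (ha : ∀ x y, p x → p y → p (x + y)) (hs : ∀ (c : K) x, p x → p (c • x))
    (x : OF K α) : p x := by
  have key : ∀ w : List (PTree α), p (forest K w) := fun w =>
    PTree.rec_1 (motive_1 := fun t => p (forest K [t])) (motive_2 := fun w => p (forest K w))
      (fun a w hw => by rw [← graft_bullet]; exact hb a w hw) h1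
      (fun t w ht hw => by rw [forest_cons]; exact hm t _ ht hw) w
  exact forest_induction h0 key ha hs x

/-- For a Lie polynomial `z`, the operator `u ↦ z u + z ▷ u` is a coderivation. -/
theorem deshuffle_lie_mul_add_graft {z : OF K α} (hz : z ∈ LiePT K α) (u : OF K α) :
    deshuffle K α (z * u + graft K z u) =
      TensorProduct.map (LinearMap.mulLeft K z + graft K z) LinearMap.id (deshuffle K α u) +
      TensorProduct.map LinearMap.id (LinearMap.mulLeft K z + graft K z) (deshuffle K α u) := by
  have h1 : ∀ T : OF K α ⊗[K] OF K α, (z ⊗ₜ 1 + 1 ⊗ₜ z) * T =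
      TensorProduct.map (LinearMap.mulLeft K z) LinearMap.id T +
      TensorProduct.map LinearMap.id (LinearMap.mulLeft K z) T := fun T => by
    induction T with
    | zero => simp
    | tmul p q => simp [add_mul]
    | add p q hp hq => rw [mul_add, hp, hq, map_add, map_add]; abel
  -- Along `deshuffle`, both sides are derivations in `u`, and they agree on trees because `z ▷ t`
  -- is again a Lie polynomial.
  have h2 : deshuffle K α (graft K z u) = TensorProduct.map (graft K z) LinearMap.id (deshuffle K α u) +
      TensorProduct.map LinearMap.id (graft K z) (deshuffle K α u) := by
    induction u using forest_induction with
    | h0 => simp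
    | ha u v hu hv => simp only [map_add, hu, hv]; abel
    | hs c u hu => simp only [map_smul, hu, smul_add]
    | hf w =>
      induction w with
      | nil =>
        simp [forest_nil, graft_lie_one hz, Algebra.TensorProduct.one_def]
      | cons t w ih =>
        have hleib : ∀ S T : OF K α ⊗[K] OF K α,
            TensorProduct.map (graft K z) LinearMap.id (S * T) +
              TensorProduct.map LinearMap.id (graft K z) (S * T) =
            (TensorProduct.map (graft K z) LinearMap.id S +
              TensorProduct.map LinearMap.id (graft K z) S) * T +
            S * (TensorProduct.map (graft K z) LinearMap.id T +
              TensorProduct.map LinearMap.id (graft K z) T) := fun S T => by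
          induction S with
          | zero => simp
          | add p q hp hq =>
            rw [add_mul, map_add, map_add, map_add, map_add, add_add_add_comm, hp, hq]
            simp only [add_mul]; abel
          | tmul p q =>
            induction T with
            | zero => simp
            | add p q hp hq =>
              rw [mul_add, map_add, map_add, map_add, map_add, add_add_add_comm, hp, hq]
              simp only [mul_add]; abel
            | tmul p' q' =>
              simp only [Algebra.TensorProduct.tmul_mul_tmul, TensorProduct.map_tmul,
                LinearMap.id_apply, graft_lie_mul hz, add_mul, mul_add, TensorProduct.add_tmul,
                TensorProduct.tmul_add]
              abel
        rw [forest_cons, graft_lie_mul hz, map_add, map_mul, map_mul, map_mul, hleib, ih,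
          deshuffle_of_mem (graft_mem z (tree_mem t)), deshuffle_tree]
        simp [graft_lie_one hz]
  rw [map_add, map_mul, deshuffle_of_mem hz, h1, h2, TensorProduct.map_add_left,
    TensorProduct.map_add_right]
  simp only [LinearMap.add_apply]
  abel

/-- Grafting `v` and then a Lie polynomial `z` onto `w`: the trees of `z` end up on a vertex of `w`
or of `v`. So `z v + z ▷ v` is the Grossman-Larson product of `z` and `v`. -/
theorem graft_lie_graft {z : OF K α} (hz : z ∈ LiePT K α) (v w : OF K α) :
    graft K z (graft K v w) = graft K (z * v + graft K z v) w := by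
  induction w using tree_forest_induction generalizing v with
  | h0 => simp
  | ha u w hu hw => simp only [map_add, hu, hw]
  | hs c u hu => simp only [map_smul, hu]
  | h1 =>
    rw [graft_right_one, map_smul, graft_lie_one hz, graft_right_one, map_add, map_mul,
      augmentation_of_mem hz, augmentation_graft_lie hz]
    simp
  | hm t x ht hx =>
    rw [graft_mul_eq, graft_mul_eq, deshuffle_lie_mul_add_graft hz]
    induction deshuffle K α v with
    | zero => simp
    | add p q hp hq => simp only [map_add, hp, hq]; abel
    | tmul p q => simp [graft_lie_mul hz, ht, hx]
  | hb a cs ih =>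
    rw [graft_graft_bullet, graft_graft_bullet, graft_graft_bullet, deshuffle_of_mem hz,
      deshuffle_lie_mul_add_graft hz, map_add, graftRight_tmul, graftRight_tmul, graft_one, one_mul]
    congr 2
    induction deshuffle K α v with
    | zero => simp
    | add p q hp hq =>
      rw [map_add, mul_add, map_add, add_add_add_comm, hp, hq]; simp only [map_add]; abel
    | tmul p q =>
      simp only [graftRight_tmul, map_add, graft_lie_mul hz, ih, TensorProduct.map_tmul,
        LinearMap.add_apply, LinearMap.mulLeft_apply, LinearMap.id_apply, add_mul, mul_add,
        mul_assoc]
      abel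

end Grafting

/-! ### Substitution is a morphism for grafting -/

section Substitution

variable {K : Type*} [Field K] {α β γ : Type}

theorem subst_forest (x : α → OF K β) (w : List (PTree α)) :
    subst K x (forest K w) = substForest K x w := by
  induction w with
  | nil => rw [forest_nil, map_one, substForest]
  | cons t w ih => rw [forest_cons, map_mul, ih, subst_tree, substForest]

theorem subst_graft_bullet (x : α → OF K β) (u : OF K α) (a : α) :
    subst K x (graft K u (forest K [bullet a])) = graft K (subst K x u) (x a) := by
  induction u using forest_induction with
  | h0 => simp
  | ha u v hu hv => simp [hu, hv]
  | hs c u hu => simp [hu]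
  | hf w => rw [graft_bullet, subst_tree, substTree, subst_forest]

theorem subst_bullet (x : α → OF K β) (a : α) : subst K x (forest K [bullet a]) = x a := by
  have h := subst_graft_bullet x 1 a
  rwa [graft_one, map_one, graft_one] at h

/-- The case of `subst_graft` in which a Lie polynomial is grafted, by induction on the number of
vertices of `v`. -/
theorem subst_graft_lie {x : α → OF K β} (hx : ∀ a, x a ∈ LiePT K β) {z : OF K α}
    (hz : z ∈ LiePT K α) (v : OF K α) :
    subst K x (graft K z v) = graft K (subst K x z) (subst K x v) := by
  have hz' : subst K x z ∈ LiePT K β := subst_mem (fun a => ⟨x a, hx a⟩) hz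
  induction v using tree_forest_induction with
  | h0 => simp
  | ha u w hu hw => simp only [map_add, hu, hw]
  | hs c u hu => simp only [map_smul, hu]
  | h1 => rw [graft_lie_one hz, map_zero, map_one, graft_lie_one hz']
  | hm t u ht hu =>
    rw [graft_lie_mul hz, map_add, map_mul, map_mul, map_mul, graft_lie_mul hz', ht, hu]
  | hb a cs ih =>
    rw [graft_lie_graft hz, subst_graft_bullet, subst_graft_bullet, graft_lie_graft hz', map_add,
      map_mul, ih]

theorem graftForest_length (v w u : List (PTree α)) (hu : u ∈ graftForest v w) :
    u.length = v.length := by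
  induction v generalizing w u with
  | nil => cases w <;> simp_all [graftForest]
  | cons t v ih =>
    simp only [graftForest, List.mem_flatMap, List.mem_map] at hu
    obtain ⟨p, -, s, -, f, hf, rfl⟩ := hu
    simp [ih _ _ hf]

/-- Substitution of Lie polynomials is compatible with grafting. Grafting of a product `t u'`
reduces to shorter forests, because it differs from grafting `u'` and then `t` by grafting
`t ▷ u'`, which is a sum of forests of the same length as `u'`. -/
theorem subst_graft {x : α → OF K β} (hx : ∀ a, x a ∈ LiePT K β) (u v : OF K α) :
    subst K x (graft K u v) = graft K (subst K x u) (subst K x v) := by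
  have key : ∀ (n : ℕ) (w : List (PTree α)), w.length = n → ∀ v : OF K α,
      subst K x (graft K (forest K w) v) = graft K (subst K x (forest K w)) (subst K x v) := by
    intro n
    induction n with
    | zero =>
      intro w hw v
      rw [List.length_eq_zero_iff.1 hw, forest_nil, graft_one, map_one, graft_one]
    | succ n ih =>
      intro w hw v
      cases w with
      | nil => simp at hw
      | cons t w =>
        simp only [List.length_cons, Nat.add_right_cancel_iff] at hw
        have ht := tree_mem (K := K) t
        have ht' : subst K x (forest K [t]) ∈ LiePT K β := subst_mem (fun a => ⟨x a, hx a⟩) ht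
        have h1 : ∀ v, subst K x (graft K (graft K (forest K [t]) (forest K w)) v) =
            graft K (subst K x (graft K (forest K [t]) (forest K w))) (subst K x v) := fun v => by
          rw [graft_forest]
          have hL := graftForest_length w [t]
          generalize graftForest w [t] = L at hL
          induction L with
          | nil => simp
          | cons f L ihL =>
            simp only [List.map_cons, List.sum_cons, map_add, LinearMap.add_apply]
            rw [ih f ((hL f List.mem_cons_self).trans hw),
              ihL fun f hf => hL f (List.mem_cons_of_mem _ hf)]
        have h2 : graft K (forest K (t :: w)) v = graft K (forest K [t]) (graft K (forest K w) v) -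
            graft K (graft K (forest K [t]) (forest K w)) v := by
          rw [graft_lie_graft ht, forest_cons, map_add]; simp
        rw [h2, map_sub, h1, subst_graft_lie hx ht, subst_graft_lie hx ht, ih w hw,
          graft_lie_graft ht', forest_cons t w, map_mul, map_add]
        simp
  induction u using forest_induction with
  | h0 => simp
  | ha u w hu hw => simp only [map_add, LinearMap.add_apply, hu, hw]
  | hs c u hu => simp only [map_smul, LinearMap.smul_apply, hu]
  | hf w => exact key _ w rfl v

mutual
theorem subst_substTree {x : β → OF K γ} (hx : ∀ a, x a ∈ LiePT K γ) (y : α → OF K β) :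
    ∀ t : PTree α, subst K x (substTree K y t) = substTree K (fun a => subst K x (y a)) t
  | .node a cs => by
    rw [substTree, substTree, subst_graft hx, subst_substForest hx y cs]
theorem subst_substForest {x : β → OF K γ} (hx : ∀ a, x a ∈ LiePT K γ) (y : α → OF K β) :
    ∀ w : List (PTree α),
      subst K x (substForest K y w) = substForest K (fun a => subst K x (y a)) w
  | [] => by simp [substForest]
  | c :: cs => by
    rw [substForest, substForest, map_mul, subst_substForest hx y cs, subst_substTree hx y c]
end

/-- Substitutions of Lie polynomials compose. -/
theorem substLie_substLie (x : β → LiePT K γ) (y : α → LiePT K β) (z : LiePT K α) :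
    substLie K x (substLie K y z) = substLie K (fun a => substLie K x (y a)) z := by
  have h : (subst K fun a => (x a : OF K γ)).comp (subst K fun a => (y a : OF K β)) =
      subst K (fun a => subst K (fun a => (x a : OF K γ)) (y a : OF K β)) := OF_algHom_ext fun t => by
    rw [AlgHom.comp_apply, subst_tree, subst_tree, subst_substTree fun a => (x a).2]
  exact Subtype.ext (congrArg (fun g => g (z : OF K α)) h)

theorem substLie_lie (x : α → LiePT K β) (u v : LiePT K α) :
    substLie K x ⁅u, v⁆ = ⁅substLie K x u, substLie K x v⁆ := by
  apply Subtype.ext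
  change subst K _ ((⁅u, v⁆ : LiePT K α) : OF K α) = (⁅_, _⁆ : OF K β)
  rw [LieSubalgebra.coe_bracket, LieRing.of_associative_ring_bracket, map_sub, map_mul, map_mul,
    LieRing.of_associative_ring_bracket]
  rfl

/-- Substitution of Lie polynomials into an unlabelled Lie polynomial amounts to substitution
into a labelled one that does not distinguish the labels. -/
theorem substLie_relabel (x : β → LiePT K γ) (f : α → β) (z : LiePT K α) :
    substLie K x (relabel K f z) = substLie K (fun a => x (f a)) z := by
  have hb : ∀ w : List (PTree α), substForest K (fun a => (x a : OF K γ)) (forestMap f w) =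
      substForest K (fun a => (x (f a) : OF K γ)) w := fun w =>
    PTree.rec_1 (motive_1 := fun t => substTree K (fun a => (x a : OF K γ)) (t.map f) =
        substTree K (fun a => (x (f a) : OF K γ)) t)
      (motive_2 := fun w => substForest K (fun a => (x a : OF K γ)) (forestMap f w) =
        substForest K (fun a => (x (f a) : OF K γ)) w)
      (fun a w hw => by rw [PTree.map, substTree, substTree, hw]) (by rw [forestMap]; rfl)
      (fun t w ht hw => by rw [forestMap, substForest, substForest, ht, hw]) w
  have h : (subst K fun a => (x a : OF K γ)).comp (relabelOF f) =
      subst K (fun a => (x (f a) : OF K γ)) := OF_algHom_ext fun t => by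
    rw [AlgHom.comp_apply, relabelOF_forest, subst_forest, subst_forest, hb]
  exact Subtype.ext (congrArg (fun g => g (z : OF K α)) h)

theorem relabel_lieEval (f : α → β) (w : FreeMagma (PTree α)) :
    relabel K f (lieEval K w) = lieEval K (FreeMagma.map (PTree.map f) w) := by
  induction w with
  | ih1 t =>
    apply Subtype.ext
    change relabelOF f (forest K [t]) = forest K [t.map f]
    rw [relabelOF_forest, forestMap, forestMap]
  | ih2 u v hu hv =>
    change _ = ⁅lieEval K (FreeMagma.map (PTree.map f) u), lieEval K (FreeMagma.map (PTree.map f) v)⁆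
    rw [← hu, ← hv]
    apply Subtype.ext
    change relabelOF f (⁅(lieEval K u : OF K α), (lieEval K v : OF K α)⁆) =
      ⁅relabelOF f (lieEval K u : OF K α), relabelOF f (lieEval K v : OF K α)⁆
    rw [LieRing.of_associative_ring_bracket, map_sub, map_mul, map_mul,
      LieRing.of_associative_ring_bracket]

/-! ### Multilinearity of the substitution -/

mutual
theorem substTree_congr {x y : α → OF K β} : ∀ t : PTree α, (∀ a ∈ t.labels, x a = y a) →
    substTree K x t = substTree K y t
  | .node a cs, h => by
    rw [PTree.labels] at h
    rw [substTree, substTree, h a (by simp), substForest_congr cs fun b hb => h b (by simp [hb])]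
theorem substForest_congr {x y : α → OF K β} : ∀ w : List (PTree α),
    (∀ a ∈ forestLabels w, x a = y a) → substForest K x w = substForest K y w
  | [], _ => rfl
  | c :: cs, h => by
    rw [forestLabels] at h
    rw [substForest, substForest, substTree_congr c fun b hb => h b (by simp [hb]),
      substForest_congr cs fun b hb => h b (by simp [hb])]
end

mutual
theorem substTree_smul (c : α → K) (x : α → OF K β) : ∀ t : PTree α,
    substTree K (fun a => c a • x a) t = (t.labels.map c).prod • substTree K x t
  | .node a cs => by
    rw [substTree, substTree, substForest_smul c x cs, PTree.labels, map_smul, map_smul,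
      LinearMap.smul_apply, List.map_cons, List.prod_cons, mul_smul]
theorem substForest_smul (c : α → K) (x : α → OF K β) : ∀ w : List (PTree α),
    substForest K (fun a => c a • x a) w = ((forestLabels w).map c).prod • substForest K x w
  | [] => by simp [substForest, forestLabels]
  | t :: w => by
    rw [substForest, substForest, substTree_smul c x t, substForest_smul c x w, forestLabels,
      List.map_append, List.prod_append, smul_mul_smul_comm]
end

section Update

variable [DecidableEq α]

theorem substTree_update_of_notMem (x : α → OF K β) (a : α) (p : OF K β) {t : PTree α}
    (h : a ∉ t.labels) : substTree K (Function.update x a p) t = substTree K x t :=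
  substTree_congr t fun b hb => Function.update_of_ne (fun e : b = a => h (e ▸ hb)) _ _

theorem substForest_update_of_notMem (x : α → OF K β) (a : α) (p : OF K β) {w : List (PTree α)}
    (h : a ∉ forestLabels w) : substForest K (Function.update x a p) w = substForest K x w :=
  substForest_congr w fun b hb => Function.update_of_ne (fun e : b = a => h (e ▸ hb)) _ _

/-! Substitution is additive in the entry at a label that occurs exactly once. -/

mutual
theorem substTree_update_add (x : α → OF K β) (a : α) (p q : OF K β) : ∀ t : PTree α,
    t.labels.count a = 1 → substTree K (Function.update x a (p + q)) t =
      substTree K (Function.update x a p) t + substTree K (Function.update x a q) t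
  | .node b cs, h => by
    rw [PTree.labels, List.count_cons] at h
    simp only [substTree]
    by_cases hb : b = a
    · have h' : a ∉ forestLabels cs := by
        rw [← List.count_eq_zero]; simp [hb] at h; simpa using h
      simp only [substForest_update_of_notMem _ _ _ h', hb, Function.update_self, map_add]
    · simp only [Function.update_of_ne hb]
      rw [substForest_update_add x a p q cs (by simpa [hb] using h), map_add, LinearMap.add_apply]
theorem substForest_update_add (x : α → OF K β) (a : α) (p q : OF K β) : ∀ w : List (PTree α),
    (forestLabels w).count a = 1 → substForest K (Function.update x a (p + q)) w =
      substForest K (Function.update x a p) w + substForest K (Function.update x a q) w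
  | [], h => by simp [forestLabels] at h
  | t :: w, h => by
    rw [forestLabels, List.count_append] at h
    simp only [substForest]
    rcases Nat.eq_zero_or_pos (t.labels.count a) with h0 | h0
    · have h' := List.count_eq_zero.1 h0
      simp only [substTree_update_of_notMem _ _ _ h']
      rw [substForest_update_add x a p q w (by omega), mul_add]
    · have h' : a ∉ forestLabels w := List.count_eq_zero.1 (by omega)
      simp only [substForest_update_of_notMem _ _ _ h']
      rw [substTree_update_add x a p q t (by omega), add_mul]
end

end Update

theorem substLie_lieEval_of (x : α → LiePT K β) (t : PTree α) :
    (substLie K x (lieEval K (.of t)) : OF K β) = substTree K (fun a => (x a : OF K β)) t :=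
  subst_tree _ t

theorem lieEval_mul (u v : FreeMagma (PTree α)) : lieEval K (u * v) = ⁅lieEval K u, lieEval K v⁆ :=
  rfl

theorem monLabels_mul (u v : FreeMagma (PTree α)) :
    monLabels (u * v) = monLabels u ++ monLabels v := rfl

theorem substLie_lieEval_congr {x y : α → LiePT K β} (w : FreeMagma (PTree α))
    (h : ∀ a ∈ monLabels w, x a = y a) :
    substLie K x (lieEval K w) = substLie K y (lieEval K w) := by
  induction w with
  | ih1 t =>
    apply Subtype.ext
    rw [substLie_lieEval_of, substLie_lieEval_of]
    exact substTree_congr t fun a ha => by rw [h a ha]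
  | ih2 u v hu hv =>
    rw [monLabels_mul] at h
    rw [lieEval_mul, substLie_lie, substLie_lie, hu fun a ha => h a (by simp [ha]),
      hv fun a ha => h a (by simp [ha])]

theorem substLie_lieEval_smul (c : α → K) (x : α → LiePT K β) (w : FreeMagma (PTree α)) :
    substLie K (fun a => c a • x a) (lieEval K w) =
      ((monLabels w).map c).prod • substLie K x (lieEval K w) := by
  induction w with
  | ih1 t =>
    apply Subtype.ext
    rw [substLie_lieEval_of]
    refine (substTree_smul c (fun a => (x a : OF K β)) t).trans ?_
    rw [← substLie_lieEval_of]; rfl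
  | ih2 u v hu hv =>
    rw [lieEval_mul, substLie_lie, substLie_lie, hu, hv, monLabels_mul, List.map_append,
      List.prod_append, smul_lie, lie_smul, mul_smul]

theorem substLie_lieEval_update_add [DecidableEq α] (x : α → LiePT K β) (a : α)
    (p q : LiePT K β) (w : FreeMagma (PTree α)) (h : (monLabels w).count a = 1) :
    substLie K (Function.update x a (p + q)) (lieEval K w) =
      substLie K (Function.update x a p) (lieEval K w) +
        substLie K (Function.update x a q) (lieEval K w) := by
  have hcoe : ∀ p : LiePT K β, (fun b => ((Function.update x a p b : LiePT K β) : OF K β)) =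
      Function.update (fun b => (x b : OF K β)) a p := fun p => by
    ext1 b
    by_cases hb : b = a
    · subst hb; simp
    · simp [hb]
  have hcongr : ∀ (w : FreeMagma (PTree α)), a ∉ monLabels w → ∀ p : LiePT K β,
      substLie K (Function.update x a p) (lieEval K w) = substLie K x (lieEval K w) :=
    fun w hw p => substLie_lieEval_congr w fun b hb =>
      Function.update_of_ne (fun e : b = a => hw (e ▸ hb)) _ _
  induction w with
  | ih1 t =>
    apply Subtype.ext
    rw [AddMemClass.coe_add]
    simp only [substLie_lieEval_of, hcoe]
    exact substTree_update_add _ a _ _ t h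
  | ih2 u v hu hv =>
    rw [monLabels_mul, List.count_append] at h
    simp only [lieEval_mul, substLie_lie]
    rcases Nat.eq_zero_or_pos ((monLabels u).count a) with h0 | h0
    · simp only [hcongr u (List.count_eq_zero.1 h0)]
      rw [hv (by omega), lie_add]
    · simp only [hcongr v (List.count_eq_zero.1 (by omega))]
      rw [hu (by omega), add_lie]

/-- Substitution into a labelled Lie monomial is a multilinear map. -/
noncomputable def substMultilinear {n : ℕ} (w : FreeMagma (PTree (Fin n))) (hw : IsLabelled w) :
    MultilinearMap K (fun _ : Fin n => LiePT K β) (LiePT K β) :=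
  MultilinearMap.mk' (fun x => substLie K x (lieEval K w))
    (fun x a p q => substLie_lieEval_update_add x a p q w (by rw [hw.count_eq]; simp))
    (fun x a c p => by
      have h : Function.update x a (c • p) =
          fun b => (Function.update (fun _ => (1 : K)) a c b) • Function.update x a p b := by
        ext1 b
        by_cases hb : b = a
        · subst hb; simp
        · simp [hb]
      rw [h, substLie_lieEval_smul, (hw.map _).prod_eq, ← Fin.prod_univ_def,
        Finset.prod_update_of_mem (Finset.mem_univ a)]
      simp)

theorem substMultilinear_apply {n : ℕ} (w : FreeMagma (PTree (Fin n))) (hw : IsLabelled w)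
    (x : Fin n → LiePT K β) : substMultilinear w hw x = substLie K x (lieEval K w) := rfl

mutual
theorem substTree_bullet : ∀ t : PTree α,
    substTree K (fun a => forest K [bullet a]) t = forest K [t]
  | .node a cs => by rw [substTree, substForest_bullet cs, graft_bullet]
theorem substForest_bullet : ∀ w : List (PTree α),
    substForest K (fun a => forest K [bullet a]) w = forest K w
  | [] => rfl
  | c :: cs => by rw [substForest, substTree_bullet c, substForest_bullet cs, ← forest_cons]
end

theorem substLie_lieEval_bullet (x : α → LiePT K β) (a : α) :
    substLie K x (lieEval K (.of (bullet a))) = x a :=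
  Subtype.ext (subst_bullet _ a)

theorem substLie_bullet (z : LiePT K α) :
    substLie K (fun a => lieEval K (.of (bullet a))) z = z := by
  have h : subst K (fun a => forest K [bullet a]) = AlgHom.id K (OF K α) :=
    OF_algHom_ext fun t => by rw [subst_tree, substTree_bullet]; rfl
  exact Subtype.ext (congrArg (fun g => g (z : OF K α)) h)

end Substitution

/-! ### Counting Lie monomials and labellings -/

section Counting

variable {α β : Type}

theorem PTree.labels_ne_nil (t : PTree α) : t.labels ≠ [] := by
  cases t; simp [PTree.labels]

theorem numVertices_pos (w : FreeMagma (PTree α)) : 0 < numVertices w := by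
  induction w with
  | ih1 t => exact List.length_pos_iff.2 t.labels_ne_nil
  | ih2 u v hu hv => simp [numVertices, monLabels_mul] at *; omega

theorem numVertices_mul (u v : FreeMagma (PTree α)) :
    numVertices (u * v) = numVertices u + numVertices v := by
  simp [numVertices, monLabels_mul]

theorem finite_forests [Finite α] (N : ℕ) :
    {w : List (PTree α) | (forestLabels w).length ≤ N}.Finite := by
  induction N with
  | zero =>
    refine (Set.finite_singleton []).subset fun w hw => ?_
    cases w with
    | nil => rfl
    | cons t w => simp [forestLabels, t.labels_ne_nil] at hw
  | succ N ih =>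
    refine (((Set.finite_univ (α := α)).prod (ih.prod ih)).image
      (fun p => PTree.node p.1 p.2.1 :: p.2.2)).insert [] |>.subset fun w hw => ?_
    cases w with
    | nil => exact Set.mem_insert _ _
    | cons t w =>
      obtain ⟨a, cs⟩ := t
      simp only [forestLabels, PTree.labels, Set.mem_ofPred_eq, List.length_append,
        List.length_cons] at hw
      exact Set.mem_insert_of_mem _ ⟨(a, cs, w), ⟨Set.mem_univ _, by simp; omega, by simp; omega⟩, rfl⟩

theorem finite_monomials [Finite α] (N : ℕ) :
    {w : FreeMagma (PTree α) | numVertices w ≤ N}.Finite := by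
  induction N with
  | zero => exact Set.finite_empty.subset fun w hw => (numVertices_pos w).not_ge hw
  | succ N ih =>
    have hT : {t : PTree α | t.labels.length ≤ N + 1}.Finite := by
      refine Set.Finite.of_finite_image (f := fun t => [t]) ((finite_forests (N + 1)).subset ?_) ?_
      · rintro _ ⟨t, ht, rfl⟩; simpa [forestLabels] using ht
      · exact fun s _ t _ h => by simpa using h
    refine ((hT.image FreeMagma.of).union ((ih.prod ih).image fun p => p.1 * p.2)).subset
      fun w hw => ?_
    induction w with
    | ih1 t => exact Or.inl ⟨t, hw, rfl⟩
    | ih2 u v _ _ =>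
      simp only [Set.mem_ofPred_eq, numVertices_mul] at hw
      have h1 := numVertices_pos u
      have h2 := numVertices_pos v
      exact Or.inr ⟨(u, v), ⟨by simp; omega, by simp; omega⟩, rfl⟩

mutual
theorem PTree.labels_map (f : α → β) : ∀ t : PTree α, (t.map f).labels = t.labels.map f
  | .node a cs => by rw [PTree.map, PTree.labels, PTree.labels, forestLabels_map f cs, List.map_cons]
theorem forestLabels_map (f : α → β) : ∀ w : List (PTree α),
    forestLabels (forestMap f w) = (forestLabels w).map f
  | [] => rfl
  | c :: cs => by
    rw [forestMap, forestLabels, forestLabels, forestLabels_map f cs, PTree.labels_map f c,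
      List.map_append]
end

theorem monLabels_map (f : α → β) (w : FreeMagma (PTree α)) :
    monLabels (FreeMagma.map (PTree.map f) w) = (monLabels w).map f := by
  induction w with
  | ih1 t => exact t.labels_map f
  | ih2 u v hu hv => rw [map_mul, monLabels_mul, monLabels_mul, hu, hv, List.map_append]

mutual
theorem PTree.eq_of_map_eq : ∀ s t : PTree α, (s.map fun _ => ()) = t.map (fun _ => ()) →
    s.labels = t.labels → s = t
  | .node a cs, .node b ds, h, h' => by
    simp only [PTree.map, PTree.node.injEq, true_and] at h
    simp only [PTree.labels, List.cons.injEq] at h'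
    rw [h'.1, forest_eq_of_map_eq cs ds h h'.2]
theorem forest_eq_of_map_eq : ∀ v w : List (PTree α),
    forestMap (fun _ => ()) v = forestMap (fun _ => ()) w → forestLabels v = forestLabels w → v = w
  | [], [], _, _ => rfl
  | [], _ :: _, h, _ => by simp [forestMap] at h
  | _ :: _, [], h, _ => by simp [forestMap] at h
  | s :: v, t :: w, h, h' => by
    simp only [forestMap, List.cons.injEq] at h
    have hl : s.labels.length = t.labels.length := by
      simpa [PTree.labels_map] using congrArg (fun t => t.labels.length) h.1
    obtain ⟨h1, h2⟩ := List.append_inj h' hl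
    rw [PTree.eq_of_map_eq s t h.1 h1, forest_eq_of_map_eq v w h.2 h2]
end

theorem mon_eq_of_map_eq {u v : FreeMagma (PTree α)}
    (h : FreeMagma.map (PTree.map fun _ => ()) u = FreeMagma.map (PTree.map fun _ => ()) v)
    (h' : monLabels u = monLabels v) : u = v := by
  induction u generalizing v with
  | ih1 s =>
    cases v with
    | of t =>
      have h1 : FreeMagma.of (s.map fun _ => ()) = FreeMagma.of (t.map fun _ => ()) := h
      injection h1 with h1
      exact congrArg _ (PTree.eq_of_map_eq s t h1 h')
    | mul => cases h
  | ih2 u u' hu hu' =>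
    cases v with
    | of => cases h
    | mul v v' =>
      have h0 : FreeMagma.mul (FreeMagma.map (PTree.map fun _ => ()) u)
          (FreeMagma.map (PTree.map fun _ => ()) u') =
        FreeMagma.mul (FreeMagma.map (PTree.map fun _ => ()) v)
          (FreeMagma.map (PTree.map fun _ => ()) v') := h
      injection h0 with h1 h2
      have hl : (monLabels u).length = (monLabels v).length := by
        simpa [monLabels_map] using congrArg (fun t => (monLabels t).length) h1
      obtain ⟨h3, h4⟩ := List.append_inj h' hl
      rw [hu h1 h3, hu' h2 h4]; rfl

mutual
theorem PTree.exists_labels : ∀ (t : PTree Unit) (l : List α), l.length = t.labels.length →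
    ∃ s : PTree α, s.map (fun _ => ()) = t ∧ s.labels = l
  | .node _ cs, [], h => by simp [PTree.labels] at h
  | .node _ cs, a :: l, h => by
    obtain ⟨ds, h1, h2⟩ := exists_forestLabels cs l (by simpa [PTree.labels] using h)
    exact ⟨.node a ds, by rw [PTree.map, h1], by rw [PTree.labels, h2]⟩
theorem exists_forestLabels : ∀ (w : List (PTree Unit)) (l : List α),
    l.length = (forestLabels w).length →
    ∃ v : List (PTree α), forestMap (fun _ => ()) v = w ∧ forestLabels v = l
  | [], l, h => ⟨[], rfl, by simp_all [forestLabels]⟩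
  | t :: w, l, h => by
    simp only [forestLabels, List.length_append] at h
    obtain ⟨s, h1, h2⟩ := PTree.exists_labels t (l.take t.labels.length) (by simp; omega)
    obtain ⟨v, h3, h4⟩ := exists_forestLabels w (l.drop t.labels.length) (by simp; omega)
    exact ⟨s :: v, by rw [forestMap, h1, h3], by rw [forestLabels, h2, h4, List.take_append_drop]⟩
end

theorem exists_monLabels (m : FreeMagma (PTree Unit)) (l : List α)
    (h : l.length = numVertices m) :
    ∃ w : FreeMagma (PTree α), FreeMagma.map (PTree.map fun _ => ()) w = m ∧ monLabels w = l := by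
  induction m generalizing l with
  | ih1 t =>
    obtain ⟨s, h1, h2⟩ := PTree.exists_labels t l h
    exact ⟨.of s, congrArg _ h1, h2⟩
  | ih2 u v hu hv =>
    rw [numVertices_mul] at h
    obtain ⟨u', h1, h2⟩ := hu (l.take (numVertices u)) (by simp; omega)
    obtain ⟨v', h3, h4⟩ := hv (l.drop (numVertices u)) (by simp; omega)
    exact ⟨u' * v', by rw [map_mul, h1, h3], by rw [monLabels_mul, h2, h4, List.take_append_drop]⟩

/-- A labelling of a Lie monomial amounts to an ordering of the labels. -/
noncomputable def labellingEquiv (m : FreeMagma (PTree Unit)) :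
    Labelling m ≃ {l : List (Fin (numVertices m)) // l ∈ (List.finRange (numVertices m)).permutations} :=
  Equiv.ofBijective (fun w => ⟨monLabels w.1, List.mem_permutations.2 w.2.1⟩) <| by
    constructor
    · intro u v h
      exact Subtype.ext (mon_eq_of_map_eq (u.2.2.trans v.2.2.symm) (congrArg Subtype.val h))
    · rintro ⟨l, hl⟩
      rw [List.mem_permutations] at hl
      obtain ⟨w, h1, rfl⟩ := exists_monLabels m l (by simpa using hl.length_eq)
      exact ⟨⟨w, hl, h1⟩, rfl⟩

/-- The enumeration of the labellings of a Lie monomial by the orderings of the labels. -/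
noncomputable instance (m : FreeMagma (PTree Unit)) : Fintype (Labelling m) :=
  Fintype.ofEquiv _ (labellingEquiv m).symm

theorem card_labelling (m : FreeMagma (PTree Unit)) :
    Fintype.card (Labelling m) = (numVertices m).factorial := by
  rw [Fintype.card_congr (labellingEquiv m)]
  rw [Fintype.card_of_subtype (List.finRange (numVertices m)).permutations.toFinset (by simp),
    List.toFinset_card_of_nodup (List.nodup_permutations _ (List.nodup_finRange _))]
  simp [List.length_permutations]

end Counting

/-! ### Homogeneity -/

section Homogeneous

variable {K : Type*} [Field K] {α : Type} {ι : Type*}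

/-- The dilation of `Lie(PT)`: the endomorphism that multiplies each vertex by `2`. In
characteristic zero its eigenspaces are the homogeneous components of `Lie(PT)`. -/
noncomputable def dilation (K : Type*) [Field K] : LiePT K Unit →ₗ[K] LiePT K Unit :=
  substLie K fun a => (2 : K) • lieEval K (.of (bullet a))

theorem dilation_lieEval (w : FreeMagma (PTree Unit)) :
    dilation K (lieEval K w) = (2 : K) ^ numVertices w • lieEval K w := by
  rw [dilation, substLie_lieEval_smul (fun _ => (2 : K)), substLie_bullet]
  simp [numVertices]

theorem two_pow_injective [CharZero K] : Function.Injective fun n : ℕ => (2 : K) ^ n := fun m n h =>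
  by
  have h' : (2 : K) ^ m = 2 ^ n := h
  exact Nat.pow_right_injective le_rfl (by exact_mod_cast h')

/-- Composition of homogeneous elements is homogeneous: substituting elements with `k a` vertices
for the labels `a` gives elements with `∑ a, k a` vertices. -/
theorem dilation_substLie {n : ℕ} {k : Fin n → ℕ} {x : Fin n → LiePT K Unit}
    (hx : ∀ a, dilation K (x a) = (2 : K) ^ k a • x a) {y : LiePT K (Fin n)}
    (hy : y ∈ LabelledLie K n) :
    dilation K (substLie K x y) = (2 : K) ^ (∑ a, k a) • substLie K x y := by
  have h (u) : dilation K (substLie K x u) = substLie K (fun a => (2 : K) ^ k a • x a) u := by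
    rw [dilation, substLie_substLie]
    exact congrArg (fun f => substLie K f u) (funext hx)
  induction hy using Submodule.span_induction with
  | zero => simp
  | add u v _ _ hu hv => rw [map_add, map_add, hu, hv, smul_add]
  | smul c u _ hu => rw [map_smul, map_smul, hu, smul_comm]
  | mem u hu =>
    obtain ⟨w, hw, rfl⟩ := hu
    rw [h, substLie_lieEval_smul (fun a => (2 : K) ^ k a), (hw.map _).prod_eq, ← Fin.prod_univ_def,
      Finset.prod_pow_eq_pow_sum]

theorem dilation_unlabel {n : ℕ} {x : LiePT K (Fin n)} (hx : x ∈ LabelledLie K n) :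
    dilation K (unlabel K x) = (2 : K) ^ n • unlabel K x := by
  induction hx using Submodule.span_induction with
  | zero => simp
  | add u v _ _ hu hv => rw [map_add, map_add, hu, hv, smul_add]
  | smul c u _ hu => rw [map_smul, map_smul, hu, smul_comm]
  | mem u hu =>
    obtain ⟨w, hw, rfl⟩ := hu
    rw [unlabel, relabel_lieEval, dilation_lieEval, numVertices, monLabels_map, List.length_map,
      hw.length_eq, List.length_finRange]

namespace LieBasis

variable (b : LieBasis K ι)

theorem mon_injective : Function.Injective b.mon := fun i j h =>
  b.basis.injective (by rw [b.basis_eq, b.basis_eq, h])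

theorem repr_dilation (x : LiePT K Unit) (i : ι) :
    b.basis.repr (dilation K x) i = (2 : K) ^ numVertices (b.mon i) * b.basis.repr x i := by
  have h : b.basis.coord i ∘ₗ dilation K =
      (2 : K) ^ numVertices (b.mon i) • b.basis.coord i := b.basis.ext fun j => by
    rw [LinearMap.comp_apply, b.basis_eq, dilation_lieEval, map_smul, ← b.basis_eq]
    by_cases hij : j = i
    · subst hij; simp
    · simp [hij]
  exact congrArg (fun f => f x) h

theorem numVertices_eq_of_repr_ne_zero [CharZero K] {n : ℕ} {x : LiePT K Unit}
    (hx : dilation K x = (2 : K) ^ n • x) {i : ι} (hi : b.basis.repr x i ≠ 0) :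
    numVertices (b.mon i) = n := by
  have h := b.repr_dilation x i
  rw [hx, map_smul, Finsupp.smul_apply, smul_eq_mul] at h
  exact (two_pow_injective (K := K) (mul_right_cancel₀ hi h)).symm

/-- An eigenvector of the dilation is a combination of the basis monomials with its eigenvalue. -/
theorem mem_lieGrade [CharZero K] (b : LieBasis K ι) {n : ℕ} {x : LiePT K Unit}
    (hx : dilation K x = (2 : K) ^ (n + 1) • x) : x ∈ lieGrade K n := by
  rw [← b.basis.linearCombination_repr x, Finsupp.linearCombination_apply]
  refine Submodule.sum_mem _ fun i hi => Submodule.smul_mem _ _ (Submodule.subset_span ?_)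
  refine ⟨b.mon i, ?_, b.basis_eq i⟩
  rw [monDegree, b.numVertices_eq_of_repr_ne_zero hx (Finsupp.mem_support_iff.1 hi)]
  rfl

theorem dilation_basis (i : ι) :
    dilation K (b.basis i) = (2 : K) ^ numVertices (b.mon i) • b.basis i := by
  rw [b.basis_eq, dilation_lieEval]

theorem sum_numVertices_of_coeff_ne_zero [CharZero K] {i : ι} {c : b.Term} (hc : b.coeff i c ≠ 0) :
    ∑ a, numVertices (b.mon (c.2.2 a)) = numVertices (b.mon i) :=
  (b.numVertices_eq_of_repr_ne_zero
    (dilation_substLie (fun a => b.dilation_basis (c.2.2 a))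
      (Submodule.subset_span ⟨_, c.2.1.2.1, rfl⟩)) (right_ne_zero_of_mul hc)).symm

/-- The index terms of the coproduct with `ω₁, …, ωₙ` among `A` and `ω'` among `B`. -/
noncomputable def termsIn (A B : Finset ι) : Finset b.Term :=
  B.sigma fun i => Finset.univ ×ˢ Fintype.piFinset fun _ : Fin (numVertices (b.mon i)) => A

theorem mem_termsIn {A B : Finset ι} {c : b.Term} :
    c ∈ b.termsIn A B ↔ c.1 ∈ B ∧ ∀ a, c.2.2 a ∈ A := by
  simp [termsIn]

/-- In a nonzero term the vertices of `ω₁, …, ωₙ` add up to those of the given monomial, so that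
`n` and the sizes of the `ωₐ` are bounded. -/
theorem finite_coeff_ne_zero [CharZero K] (i : ι) : {c : b.Term | b.coeff i c ≠ 0}.Finite := by
  have hS : {j | numVertices (b.mon j) ≤ numVertices (b.mon i)}.Finite :=
    (finite_monomials (numVertices (b.mon i))).preimage b.mon_injective.injOn
  refine (b.termsIn hS.toFinset hS.toFinset).finite_toSet.subset fun c hc => ?_
  have h := b.sum_numVertices_of_coeff_ne_zero hc
  rw [Finset.mem_coe, mem_termsIn]
  simp only [Set.Finite.mem_toFinset, Set.mem_ofPred_eq, ← h]
  constructor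
  · calc numVertices (b.mon c.1) = ∑ _a : Fin (numVertices (b.mon c.1)), 1 := by simp
      _ ≤ _ := Finset.sum_le_sum fun a _ => numVertices_pos _
  · exact fun a => Finset.single_le_sum (f := fun a => numVertices (b.mon (c.2.2 a)))
      (fun _ _ => Nat.zero_le _) (Finset.mem_univ a)

end LieBasis

end Homogeneous

/-! ### Characters of the symmetric algebra -/

section Separation

variable {K V W I J : Type*} [Field K] [AddCommGroup V] [Module K V] [AddCommGroup W] [Module K W]

/-- Products of functionals from two separating families separate the points of the tensor
product. -/
theorem tensor_eq_zero_of_separating {f : I → V →ₗ[K] K} {g : J → W →ₗ[K] K}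
    (hf : ∀ v, (∀ i, f i v = 0) → v = 0) (hg : ∀ w, (∀ j, g j w = 0) → w = 0) (T : V ⊗[K] W)
    (hT : ∀ i j, LinearMap.mul' K K (TensorProduct.map (f i) (g j) T) = 0) : T = 0 := by
  classical
  set c := Module.Basis.ofVectorSpace K W
  have h1 : ∀ i, TensorProduct.lid K W ((f i).rTensor W T) = 0 := fun i => hg _ fun j => by
    rw [← hT i j]
    clear hT
    induction T with
    | zero => simp
    | tmul v w => simp
    | add p q hp hq => simp only [map_add, hp, hq]
  have h2 : ∀ (i) (k) (T : V ⊗[K] W), c.repr (TensorProduct.lid K W ((f i).rTensor W T)) k =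
      f i (TensorProduct.equivFinsuppOfBasisRight c T k) := fun i k T => by
    induction T with
    | zero => simp
    | tmul v w => simp [mul_comm]
    | add p q hp hq => simp only [map_add, Finsupp.add_apply, hp, hq]
  refine (TensorProduct.equivFinsuppOfBasisRight c).map_eq_zero_iff.1 (Finsupp.ext fun k => ?_)
  exact hf _ fun i => by rw [← h2, h1]; simp

theorem mul'_map_eq_productMap {A B : Type*} [CommRing A] [Algebra K A] [CommRing B] [Algebra K B]
    (f : A →ₐ[K] K) (g : B →ₐ[K] K) (T : A ⊗[K] B) :
    LinearMap.mul' K K (TensorProduct.map f.toLinearMap g.toLinearMap T) =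
      Algebra.TensorProduct.productMap f g T := by
  induction T with
  | zero => simp
  | tmul p q => simp
  | add p q hp hq => simp only [map_add, hp, hq]

end Separation

section Bialgebra

variable {K : Type*} [Field K] {ι : Type*}

namespace LieBasis

/-- The character of `S(Lie(PT))` given by a Lie polynomial `φ`: it maps a basis monomial to its
coefficient in `φ`. -/
noncomputable def character (b : LieBasis K ι) (φ : LiePT K Unit) : SLie K →ₐ[K] K :=
  SymmetricAlgebra.lift (b.basis.constr K (b.basis.repr φ))

variable (b : LieBasis K ι)

theorem character_basis (φ : LiePT K Unit) (i : ι) :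
    b.character φ (SymmetricAlgebra.ι K _ (b.basis i)) = b.basis.repr φ i := by
  rw [character, SymmetricAlgebra.lift_ι_apply, Module.Basis.constr_basis]

/-- A polynomial over an infinite field that vanishes at all finitely supported points is zero. -/
theorem eq_zero_of_character [CharZero K] (x : SLie K) (hx : ∀ φ, b.character φ x = 0) :
    x = 0 := by
  set e := SymmetricAlgebra.equivMvPolynomial b.basis
  have h1 : ∀ φ, (b.character φ).comp e.symm.toAlgHom = MvPolynomial.aeval (b.basis.repr φ) :=
    fun φ => MvPolynomial.algHom_ext fun i => by
      simp [e, SymmetricAlgebra.equivMvPolynomial_symm_X, character_basis]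
  refine e.map_eq_zero_iff.1 (MvPolynomial.funext fun v => ?_)
  set p := e x
  let φ := b.basis.repr.symm (Finsupp.indicator p.vars fun j _ => v j)
  have h2 : MvPolynomial.aeval (b.basis.repr φ) p = 0 := by
    rw [← h1, AlgHom.comp_apply]
    simpa [p] using hx φ
  rw [map_zero, ← h2]
  change MvPolynomial.eval₂Hom _ _ _ = MvPolynomial.eval₂Hom _ _ _
  refine MvPolynomial.eval₂Hom_congr' rfl (fun i _ hi => ?_) rfl
  simp [φ, Finsupp.indicator_of_mem hi]

theorem substLie_eq_sum {n : ℕ} (w : FreeMagma (PTree (Fin n))) (hw : IsLabelled w)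
    (φ : LiePT K Unit) : substLie K (fun _ => φ) (lieEval K w) =
      ∑ c ∈ Fintype.piFinset fun _ : Fin n => (b.basis.repr φ).support,
        (∏ a, b.basis.repr φ (c a)) • substLie K (fun a => b.basis (c a)) (lieEval K w) := by
  have h : φ = ∑ j ∈ (b.basis.repr φ).support, b.basis.repr φ j • b.basis j := by
    conv_lhs => rw [← b.basis.linearCombination_repr φ, Finsupp.linearCombination_apply]
    rfl
  conv_lhs => rw [h]
  rw [← substMultilinear_apply w hw]
  refine (MultilinearMap.map_sum_finset _ (fun _ j => b.basis.repr φ j • b.basis j) _).trans ?_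
  refine Finset.sum_congr rfl fun c _ => ?_
  rw [MultilinearMap.map_smul_univ, substMultilinear_apply]

/-- The duality between the coproduct and substitution: the convolution of the characters of `φ`
and `ψ` is the character of the result of substituting `φ` for all vertices of `ψ`. -/
theorem productMap_comp_coprod [CharZero K] (φ ψ : LiePT K Unit) :
    (Algebra.TensorProduct.productMap (b.character φ) (b.character ψ)).comp b.coprod =
      b.character (substLie K (fun _ => φ) ψ) := by
  refine SymmetricAlgebra.algHom_ext (b.basis.ext fun i => ?_)
  set A := (b.basis.repr φ).support
  set B := (b.basis.repr ψ).support
  have hfin : (Function.support fun c : b.Term => b.coeff i c •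
      ((∏ a, SymmetricAlgebra.ι K (LiePT K Unit) (b.basis (c.2.2 a))) ⊗ₜ[K]
        SymmetricAlgebra.ι K (LiePT K Unit) (b.basis c.1))).Finite :=
    (b.finite_coeff_ne_zero i).subset fun c hc h => hc (by simp [h])
  have hl : (Algebra.TensorProduct.productMap (b.character φ) (b.character ψ))
      (b.coprodBasis i) = ∑ᶠ c : b.Term, b.coeff i c *
        ((∏ a, b.basis.repr φ (c.2.2 a)) * b.basis.repr ψ c.1) := by
    rw [coprodBasis, ← AlgHom.coe_toAddMonoidHom, AddMonoidHom.map_finsum _ hfin]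
    refine finsum_congr fun c => ?_
    simp [character_basis]
  have hs : (Function.support fun c : b.Term => b.coeff i c *
      ((∏ a, b.basis.repr φ (c.2.2 a)) * b.basis.repr ψ c.1)) ⊆ b.termsIn A B := fun c hc => by
    have h := right_ne_zero_of_mul hc
    rw [Finset.mem_coe, mem_termsIn]
    exact ⟨Finsupp.mem_support_iff.2 (right_ne_zero_of_mul h), fun a =>
      Finsupp.mem_support_iff.2 (Finset.prod_ne_zero_iff.1 (left_ne_zero_of_mul h) a
        (Finset.mem_univ a))⟩
  have hr : substLie K (fun _ => φ) ψ =
      ∑ j ∈ B, b.basis.repr ψ j • substLie K (fun _ => φ) (lieEval K (b.mon j)) := by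
    conv_lhs => rw [← b.basis.linearCombination_repr ψ, Finsupp.linearCombination_apply]
    rw [Finsupp.sum, map_sum]
    simp only [map_smul, b.basis_eq]
    rfl
  -- Substituting `φ` for all vertices does not see the labels, so that each of the `n!` labellings
  -- contributes the same.
  have hj : ∀ j, b.basis.repr (substLie K (fun _ => φ) (lieEval K (b.mon j))) i =
      ∑ w : Labelling (b.mon j), ∑ c ∈ Fintype.piFinset fun _ => A,
        b.coeff i ⟨j, w, c⟩ * ∏ a, b.basis.repr φ (c a) := fun j => by
    have hw : ∀ w : Labelling (b.mon j), ∑ c ∈ Fintype.piFinset fun _ => A,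
        b.coeff i ⟨j, w, c⟩ * ∏ a, b.basis.repr φ (c a) =
        ((numVertices (b.mon j)).factorial : K)⁻¹ *
          b.basis.repr (substLie K (fun _ => φ) (lieEval K (b.mon j))) i := fun w => by
      have hw' : substLie K (fun _ => φ) (lieEval K (b.mon j)) =
          substLie K (fun _ => φ) (lieEval K w.1) := by
        conv_lhs => rw [← w.2.2, ← relabel_lieEval, substLie_relabel]
      rw [hw', b.substLie_eq_sum w.1 w.2.1, map_sum, Finsupp.finsetSum_apply, Finset.mul_sum]
      refine Finset.sum_congr rfl fun c _ => ?_
      rw [map_smul, Finsupp.smul_apply, smul_eq_mul, coeff, comp]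
      ring
    simp only [hw, Finset.sum_const, Finset.card_univ, card_labelling, nsmul_eq_mul]
    rw [← mul_assoc, mul_inv_cancel₀ (Nat.cast_ne_zero.2 (Nat.factorial_ne_zero _)), one_mul]
  change (Algebra.TensorProduct.productMap (b.character φ) (b.character ψ))
    (b.coprod (SymmetricAlgebra.ι K _ (b.basis i))) =
      b.character _ (SymmetricAlgebra.ι K _ (b.basis i))
  rw [coprod, SymmetricAlgebra.lift_ι_apply, Module.Basis.constr_basis, hl, character_basis, hr,
    finsum_eq_sum_of_support_subset _ hs, termsIn, Finset.sum_sigma, map_sum,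
    Finsupp.finsetSum_apply]
  refine Finset.sum_congr rfl fun j _ => ?_
  rw [map_smul, Finsupp.smul_apply, hj, Finset.sum_product, smul_eq_mul, Finset.mul_sum]
  refine Finset.sum_congr rfl fun w _ => ?_
  rw [Finset.mul_sum]
  exact Finset.sum_congr rfl fun c _ => by ring

end LieBasis

/-! ### The counit -/

open Classical in
theorem coord_bullet_forest (w : List (PTree Unit)) :
    (MonoidAlgebra.basis (FreeMonoid (PTree Unit)) K).coord (FreeMonoid.ofList [bullet ()])
      (forest K w) = if w = [bullet ()] then 1 else 0 := by
  have h : forest K w = MonoidAlgebra.basis (FreeMonoid (PTree Unit)) K (FreeMonoid.ofList w) :=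
    (basis_eq_forest _).symm
  rw [h, Module.Basis.coord_apply, Module.Basis.repr_self, Finsupp.single_apply]
  exact if_congr FreeMonoid.ofList.injective.eq_iff rfl rfl

theorem bulletCoeff_bullet : bulletCoeff K (lieEval K (.of (bullet ()))) = 1 :=
  (coord_bullet_forest _).trans (if_pos rfl)

/-- A bracket has no component along a single tree, because a word `v w` of length one is equal
to `w v`. -/
theorem bulletCoeff_lie (x y : LiePT K Unit) : bulletCoeff K ⁅x, y⁆ = 0 := by
  set c := (MonoidAlgebra.basis (FreeMonoid (PTree Unit)) K).coord
    (FreeMonoid.ofList [bullet ()]) with hc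
  have h : ∀ u v : OF K Unit, c (u * v) = c (v * u) := fun u v => by
    induction u using forest_induction with
    | h0 => simp
    | ha u u' hu hu' => rw [add_mul, mul_add, map_add, map_add, hu, hu']
    | hs r u hu => rw [smul_mul_assoc, mul_smul_comm, map_smul, map_smul, hu]
    | hf p =>
      induction v using forest_induction with
      | h0 => simp
      | ha u u' hu hu' => rw [add_mul, mul_add, map_add, map_add, hu, hu']
      | hs r u hu => rw [smul_mul_assoc, mul_smul_comm, map_smul, map_smul, hu]
      | hf q =>
        rw [← forest_append, ← forest_append, hc, coord_bullet_forest, coord_bullet_forest]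
        congr 1
        rw [List.append_eq_singleton_iff, List.append_eq_singleton_iff]
        exact propext ⟨fun h => h.symm.imp And.symm And.symm, fun h => h.symm.imp And.symm And.symm⟩
  change c (⁅(x : OF K Unit), (y : OF K Unit)⁆) = 0
  rw [LieRing.of_associative_ring_bracket, map_sub, h, sub_self]

theorem bulletCoeff_lieEval_of_ne {w : FreeMagma (PTree Unit)} (hw : w ≠ .of (bullet ())) :
    bulletCoeff K (lieEval K w) = 0 := by
  cases w with
  | of t =>
    refine (coord_bullet_forest [t]).trans (if_neg fun h => hw ?_)
    rw [List.singleton_inj.1 h]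
  | mul u v => exact bulletCoeff_lie _ _

theorem counit_ι (x : LiePT K Unit) : counit K (SymmetricAlgebra.ι K _ x) = bulletCoeff K x :=
  SymmetricAlgebra.lift_ι_apply _ _

namespace LieBasis

/-- The single-vertex tree belongs to each basis of Lie monomials, because all other Lie monomials
are in the kernel of `bulletCoeff`. -/
theorem exists_mon_eq_bullet (b : LieBasis K ι) : ∃ i, b.mon i = .of (bullet ()) := by
  by_contra! h
  have h0 : bulletCoeff K = 0 := b.basis.ext fun i => by
    rw [b.basis_eq, bulletCoeff_lieEval_of_ne (h i), LinearMap.zero_apply]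
  have h1 := bulletCoeff_bullet (K := K)
  rw [h0] at h1
  exact zero_ne_one h1

variable (b : LieBasis K ι)

theorem character_bullet : b.character (lieEval K (.of (bullet ()))) = counit K := by
  refine SymmetricAlgebra.algHom_ext (b.basis.ext fun i => ?_)
  change b.character _ (SymmetricAlgebra.ι K _ (b.basis i)) =
    counit K (SymmetricAlgebra.ι K _ (b.basis i))
  obtain ⟨j, hj⟩ := b.exists_mon_eq_bullet
  rw [character_basis, counit_ι, ← hj, ← b.basis_eq, b.basis.repr_self]
  by_cases h : j = i
  · rw [← h, Finsupp.single_eq_same, b.basis_eq, hj, bulletCoeff_bullet]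
  · rw [Finsupp.single_eq_of_ne' h, b.basis_eq, bulletCoeff_lieEval_of_ne]
    exact fun h' => h (b.mon_injective (hj.trans h'.symm))

/-! ### The coalgebra axioms -/

theorem rTensor_counit_coprod [CharZero K] (x : SLie K) :
    (counit K).toLinearMap.rTensor (SLie K) (b.coprod x) = 1 ⊗ₜ x := by
  refine (TensorProduct.lid K (SLie K)).injective (sub_eq_zero.1 ?_)
  refine b.eq_zero_of_character _ fun ψ => ?_
  have h : ∀ T : SLie K ⊗[K] SLie K, b.character ψ (TensorProduct.lid K (SLie K)
      ((counit K).toLinearMap.rTensor (SLie K) T)) =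
      Algebra.TensorProduct.productMap (counit K) (b.character ψ) T := fun T => by
    induction T with
    | zero => simp
    | tmul p q => simp
    | add p q hp hq => simp only [map_add, hp, hq]
  have h' := congrArg (fun f => f x) (b.productMap_comp_coprod (lieEval K (.of (bullet ()))) ψ)
  rw [map_sub, h, ← b.character_bullet, TensorProduct.lid_tmul, one_smul, sub_eq_zero]
  refine h'.trans ?_
  rw [show (fun _ => lieEval K (.of (bullet ()))) = fun a : Unit => lieEval K (.of (bullet a))
    from rfl, substLie_bullet]

theorem lTensor_counit_coprod [CharZero K] (x : SLie K) :
    (counit K).toLinearMap.lTensor (SLie K) (b.coprod x) = x ⊗ₜ 1 := by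
  refine (TensorProduct.rid K (SLie K)).injective (sub_eq_zero.1 ?_)
  refine b.eq_zero_of_character _ fun φ => ?_
  have h : ∀ T : SLie K ⊗[K] SLie K, b.character φ (TensorProduct.rid K (SLie K)
      ((counit K).toLinearMap.lTensor (SLie K) T)) =
      Algebra.TensorProduct.productMap (b.character φ) (counit K) T := fun T => by
    induction T with
    | zero => simp
    | tmul p q => simp [mul_comm]
    | add p q hp hq => simp only [map_add, hp, hq]
  have h' := congrArg (fun f => f x) (b.productMap_comp_coprod φ (lieEval K (.of (bullet ()))))
  rw [map_sub, h, ← b.character_bullet, TensorProduct.rid_tmul, one_smul, sub_eq_zero]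
  refine h'.trans ?_
  rw [substLie_lieEval_bullet]

theorem productMap_coprod [CharZero K] (φ ψ : LiePT K Unit) (y : SLie K) :
    Algebra.TensorProduct.productMap (b.character φ) (b.character ψ) (b.coprod y) =
      b.character (substLie K (fun _ => φ) ψ) y :=
  congrArg (fun f => f y) (b.productMap_comp_coprod φ ψ)

theorem productMap_lTensor_coprod [CharZero K] (φ ψ θ : LiePT K Unit) (T : SLie K ⊗[K] SLie K) :
    Algebra.TensorProduct.productMap (b.character φ)
      (Algebra.TensorProduct.productMap (b.character ψ) (b.character θ))
        (b.coprod.toLinearMap.lTensor (SLie K) T) =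
      Algebra.TensorProduct.productMap (b.character φ)
        (b.character (substLie K (fun _ => ψ) θ)) T := by
  induction T with
  | zero => simp only [map_zero]
  | tmul p q =>
    rw [LinearMap.lTensor_tmul, AlgHom.toLinearMap_apply,
      Algebra.TensorProduct.productMap_apply_tmul, productMap_coprod,
      Algebra.TensorProduct.productMap_apply_tmul]
  | add p q hp hq => simp only [map_add, hp, hq]

theorem productMap_assoc (f g h : SLie K →ₐ[K] K) (T : SLie K ⊗[K] SLie K) (q : SLie K) :
    Algebra.TensorProduct.productMap f (Algebra.TensorProduct.productMap g h)
      (TensorProduct.assoc K (SLie K) (SLie K) (SLie K) (T ⊗ₜ q)) =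
      Algebra.TensorProduct.productMap f g T * h q := by
  induction T with
  | zero => simp only [TensorProduct.zero_tmul, map_zero, zero_mul]
  | tmul r s =>
    rw [TensorProduct.assoc_tmul, Algebra.TensorProduct.productMap_apply_tmul,
      Algebra.TensorProduct.productMap_apply_tmul, Algebra.TensorProduct.productMap_apply_tmul,
      mul_assoc]
  | add r s hr hs => simp only [TensorProduct.add_tmul, map_add, hr, hs, add_mul]

theorem productMap_assoc_rTensor_coprod [CharZero K] (φ ψ θ : LiePT K Unit)
    (T : SLie K ⊗[K] SLie K) :
    Algebra.TensorProduct.productMap (b.character φ)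
      (Algebra.TensorProduct.productMap (b.character ψ) (b.character θ))
        (TensorProduct.assoc K (SLie K) (SLie K) (SLie K)
          (b.coprod.toLinearMap.rTensor (SLie K) T)) =
      Algebra.TensorProduct.productMap (b.character (substLie K (fun _ => φ) ψ))
        (b.character θ) T := by
  induction T with
  | zero => simp only [map_zero]
  | add p q hp hq => simp only [map_add, hp, hq]
  | tmul p q =>
    rw [LinearMap.rTensor_tmul, AlgHom.toLinearMap_apply, productMap_assoc, productMap_coprod,
      Algebra.TensorProduct.productMap_apply_tmul]

/-- Pairs of characters separate the points of `S(Lie(PT)) ⊗ S(Lie(PT))`. -/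
theorem eq_zero_of_productMap [CharZero K] (T : SLie K ⊗[K] SLie K)
    (hT : ∀ p : LiePT K Unit × LiePT K Unit,
      (Algebra.TensorProduct.productMap (b.character p.1) (b.character p.2)).toLinearMap T = 0) :
    T = 0 :=
  tensor_eq_zero_of_separating (f := fun φ => (b.character φ).toLinearMap)
    (g := fun φ => (b.character φ).toLinearMap) b.eq_zero_of_character b.eq_zero_of_character T
    fun φ ψ => (mul'_map_eq_productMap _ _ T).trans (hT (φ, ψ))

/-- Coassociativity, tested on triples of characters: there it is the associativity of the
composition of substitutions. -/
theorem assoc_rTensor_coprod [CharZero K] (x : SLie K) :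
    TensorProduct.assoc K (SLie K) (SLie K) (SLie K)
      (b.coprod.toLinearMap.rTensor (SLie K) (b.coprod x)) =
      b.coprod.toLinearMap.lTensor (SLie K) (b.coprod x) := by
  refine sub_eq_zero.1 (tensor_eq_zero_of_separating
    (f := fun φ => (b.character φ).toLinearMap) b.eq_zero_of_character b.eq_zero_of_productMap _
    fun φ p => ?_)
  rw [mul'_map_eq_productMap, map_sub, productMap_lTensor_coprod, productMap_assoc_rTensor_coprod,
    productMap_coprod, productMap_coprod, substLie_substLie, sub_self]


end LieBasis

end Bialgebra

/-! ### The grading -/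

section Grading

variable {K : Type*} [Field K] {ι : Type*}

theorem unlabel_operadComp_mem [CharZero K] (b : LieBasis K ι) {d : ℕ} {e : Fin (d + 1) → ℕ}
    {x : ∀ a, LiePT K (Fin (e a + 1))} {y : LiePT K (Fin (d + 1))}
    (hx : ∀ a, x a ∈ LabelledLie K (e a + 1)) (hy : y ∈ LabelledLie K (d + 1)) :
    unlabel K (operadComp K x y) ∈ lieGrade K (∑ a, e a + d) := by
  refine b.mem_lieGrade ?_
  rw [unlabel_operadComp, dilation_substLie (fun a => dilation_unlabel (hx a)) hy,
    Finset.sum_add_distrib]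
  simp [add_assoc]

theorem monDegree_add_one (w : FreeMagma (PTree Unit)) : monDegree w + 1 = numVertices w :=
  Nat.sub_add_cancel (numVertices_pos w)

theorem lieEval_mem_symGrade (w : FreeMagma (PTree Unit)) :
    SymmetricAlgebra.ι K _ (lieEval K w) ∈ symGrade K (monDegree w) :=
  Submodule.subset_span ⟨[w], by simp, by simp⟩

theorem symGrade_gradedMonoid : SetLike.GradedMonoid (symGrade K) where
  one_mem := Submodule.subset_span ⟨[], rfl, rfl⟩
  mul_mem {c d x y} hx hy := by
    have h : symGrade K c * symGrade K d ≤ symGrade K (c + d) := by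
      rw [symGrade, symGrade, Submodule.span_mul_span, Submodule.span_le]
      rintro _ ⟨_, ⟨l, hl, rfl⟩, _, ⟨m, hm, rfl⟩, rfl⟩
      exact Submodule.subset_span ⟨l ++ m, by simp [hl, hm], by simp⟩
    exact h (Submodule.mul_mem_mul hx hy)

/-- The algebra endomorphism of `S(Lie(PT))` that multiplies a Lie monomial of degree `d` by
`2 ^ d`. -/
noncomputable def symDilation (K : Type*) [Field K] : SLie K →ₐ[K] SLie K :=
  SymmetricAlgebra.lift (SymmetricAlgebra.ι K (LiePT K Unit) ∘ₗ ((2 : K)⁻¹ • dilation K))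

theorem symDilation_lieEval [CharZero K] (w : FreeMagma (PTree Unit)) :
    symDilation K (SymmetricAlgebra.ι K _ (lieEval K w)) =
      (2 : K) ^ monDegree w • SymmetricAlgebra.ι K _ (lieEval K w) := by
  rw [symDilation, SymmetricAlgebra.lift_ι_apply, LinearMap.comp_apply, LinearMap.smul_apply,
    dilation_lieEval, ← monDegree_add_one, map_smul, map_smul, pow_succ', mul_smul,
    inv_smul_smul₀ two_ne_zero]

theorem symGrade_le_eigenspace [CharZero K] (d : ℕ) :
    symGrade K d ≤ Module.End.eigenspace (symDilation K).toLinearMap ((2 : K) ^ d) := by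
  refine Submodule.span_le.2 ?_
  rintro _ ⟨l, rfl, rfl⟩
  rw [SetLike.mem_coe, Module.End.mem_eigenspace_iff, AlgHom.toLinearMap_apply]
  induction l with
  | nil => simp
  | cons w l ih =>
    rw [List.map_cons, List.prod_cons, map_mul, ih, symDilation_lieEval, List.map_cons,
      List.sum_cons, pow_add, smul_mul_smul_comm]

theorem iSup_symGrade : ⨆ d, symGrade K d = ⊤ := by
  refine eq_top_iff.2 fun x _ => ?_
  have hm : ∀ d, ∀ x ∈ symGrade K d, x ∈ ⨆ d, symGrade K d := fun d x hx =>
    Submodule.mem_iSup_of_mem d hx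
  induction x using SymmetricAlgebra.induction with
  | algebraMap r =>
    rw [Algebra.algebraMap_eq_smul_one]
    exact Submodule.smul_mem _ _ (hm 0 _ symGrade_gradedMonoid.one_mem)
  | ι x =>
    have hx : x ∈ Submodule.span K (Set.range (lieEval K (α := Unit))) := by
      rw [span_lieEval]; trivial
    induction hx using Submodule.span_induction with
    | zero => simp
    | add x y _ _ hx hy => rw [map_add]; exact add_mem (hx trivial) (hy trivial)
    | smul c x _ hx => rw [map_smul]; exact Submodule.smul_mem _ _ (hx trivial)
    | mem x h => obtain ⟨w, rfl⟩ := h; exact hm _ _ (lieEval_mem_symGrade w)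
  | add x y hx hy => exact add_mem (hx trivial) (hy trivial)
  | mul x y hx hy =>
    have h : (⨆ d, symGrade K d) * (⨆ d, symGrade K d) ≤ ⨆ d, symGrade K d := by
      rw [Submodule.iSup_mul]
      refine iSup_le fun c => ?_
      rw [Submodule.mul_iSup]
      exact iSup_le fun d => Submodule.mul_le.2 fun x hx y hy =>
        hm (c + d) _ (symGrade_gradedMonoid.mul_mem hx hy)
    exact h (Submodule.mul_mem_mul (hx trivial) (hy trivial))

theorem symGrade_isInternal [CharZero K] : DirectSum.IsInternal (symGrade K) := by
  refine (DirectSum.isInternal_submodule_iff_iSupIndep_and_iSup_eq_top _).2 ⟨?_, iSup_symGrade⟩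
  -- Elements of degree `d` are eigenvectors for `2 ^ d`, and eigenspaces are independent.
  exact ((Module.End.eigenspaces_iSupIndep (symDilation K).toLinearMap).comp
    (two_pow_injective (K := K))).mono symGrade_le_eigenspace

theorem tmul_mem_tensorGrade {p q : ℕ} {x y : SLie K} (hx : x ∈ symGrade K p)
    (hy : y ∈ symGrade K q) : x ⊗ₜ[K] y ∈ tensorGrade K (p + q) := by
  refine Submodule.mem_iSup_of_mem (p, q) (Submodule.mem_iSup_of_mem (by simp) ?_)
  exact ⟨⟨x, hx⟩ ⊗ₜ ⟨y, hy⟩, rfl⟩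

theorem tensorGrade_le {d : ℕ} {S : Submodule K (SLie K ⊗[K] SLie K)}
    (h : ∀ p q, p + q = d → ∀ x ∈ symGrade K p, ∀ y ∈ symGrade K q, x ⊗ₜ[K] y ∈ S) :
    tensorGrade K d ≤ S := by
  refine iSup_le fun p => iSup_le fun hp => ?_
  rintro _ ⟨T, rfl⟩
  induction T with
  | zero => simp
  | add T T' hT hT' => rw [map_add]; exact add_mem hT hT'
  | tmul x y => exact h _ _ (Finset.HasAntidiagonal.mem_antidiagonal.1 hp) _ x.2 _ y.2

theorem one_mem_tensorGrade : (1 : SLie K ⊗[K] SLie K) ∈ tensorGrade K 0 := by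
  have h1 : (1 : SLie K) ∈ symGrade K 0 := symGrade_gradedMonoid.one_mem
  have h2 : (1 : SLie K) ⊗ₜ[K] (1 : SLie K) ∈ tensorGrade K (0 + 0) := tmul_mem_tensorGrade h1 h1
  rw [add_zero] at h2
  rw [Algebra.TensorProduct.one_def]
  exact h2

theorem mul_mem_tensorGrade {c d : ℕ} {S T : SLie K ⊗[K] SLie K} (hS : S ∈ tensorGrade K c)
    (hT : T ∈ tensorGrade K d) : S * T ∈ tensorGrade K (c + d) := by
  have h : tensorGrade K c ≤ (tensorGrade K (c + d)).comap (LinearMap.mulRight K T) :=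
    tensorGrade_le fun p q hc x hx y hy => by
      have h : tensorGrade K d ≤ (tensorGrade K (c + d)).comap (LinearMap.mulLeft K (x ⊗ₜ y)) :=
        tensorGrade_le fun p' q' hd x' hx' y' hy' => by
          rw [Submodule.mem_comap, LinearMap.mulLeft_apply, Algebra.TensorProduct.tmul_mul_tmul,
            ← hc, ← hd, add_add_add_comm]
          exact tmul_mem_tensorGrade (symGrade_gradedMonoid.mul_mem hx hx')
            (symGrade_gradedMonoid.mul_mem hy hy')
      exact h hT
  exact h hS

theorem prod_mem_symGrade {n : ℕ} (m : Fin n → FreeMagma (PTree Unit)) :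
    ∏ a, SymmetricAlgebra.ι K _ (lieEval K (m a)) ∈ symGrade K (∑ a, monDegree (m a)) := by
  refine Submodule.subset_span ⟨List.ofFn m, ?_, ?_⟩
  · rw [List.map_ofFn, List.sum_ofFn]; rfl
  · rw [List.map_ofFn, List.prod_ofFn]; rfl

namespace LieBasis

theorem coprodBasis_mem [CharZero K] (b : LieBasis K ι) (i : ι) :
    b.coprodBasis i ∈ tensorGrade K (monDegree (b.mon i)) := by
  refine finsum_induction (· ∈ tensorGrade K (monDegree (b.mon i))) (zero_mem _)
    (fun _ _ => add_mem) fun c => ?_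
  by_cases hc : b.coeff i c = 0
  · rw [hc, zero_smul]; exact zero_mem _
  refine Submodule.smul_mem _ _ ?_
  have hd : monDegree (b.mon i) = ∑ a, monDegree (b.mon (c.2.2 a)) + monDegree (b.mon c.1) := by
    have h := b.sum_numVertices_of_coeff_ne_zero hc
    simp only [← monDegree_add_one (b.mon (c.2.2 _)), Finset.sum_add_distrib, Finset.sum_const,
      Finset.card_univ, Fintype.card_fin, smul_eq_mul, mul_one] at h
    have h1 := monDegree_add_one (b.mon i)
    have h2 := monDegree_add_one (b.mon c.1)
    omega
  simp only [b.basis_eq]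
  rw [hd]
  exact tmul_mem_tensorGrade (prod_mem_symGrade _) (lieEval_mem_symGrade _)

theorem coprod_lieEval_mem [CharZero K] (b : LieBasis K ι) (w : FreeMagma (PTree Unit)) :
    b.coprod (SymmetricAlgebra.ι K _ (lieEval K w)) ∈ tensorGrade K (monDegree w) := by
  rw [coprod, SymmetricAlgebra.lift_ι_apply, Module.Basis.constr_apply]
  refine Submodule.sum_mem _ fun i hi => Submodule.smul_mem _ _ ?_
  have h := b.numVertices_eq_of_repr_ne_zero (dilation_lieEval w) (Finsupp.mem_support_iff.1 hi)
  rw [monDegree, ← h]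
  exact b.coprodBasis_mem i

theorem coprod_prod_mem [CharZero K] (b : LieBasis K ι) (l : List (FreeMagma (PTree Unit))) :
    b.coprod (l.map fun w => SymmetricAlgebra.ι K (LiePT K Unit) (lieEval K w)).prod ∈
      tensorGrade K (l.map monDegree).sum := by
  induction l with
  | nil =>
    rw [List.map_nil, List.map_nil, List.prod_nil, List.sum_nil, map_one]
    exact one_mem_tensorGrade
  | cons w l ih =>
    rw [List.map_cons, List.map_cons, List.prod_cons, map_mul, List.sum_cons]
    exact mul_mem_tensorGrade (b.coprod_lieEval_mem w) ih

theorem coprod_mem_tensorGrade [CharZero K] (b : LieBasis K ι) {d : ℕ} {x : SLie K}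
    (hx : x ∈ symGrade K d) : b.coprod x ∈ tensorGrade K d := by
  have h : symGrade K d ≤ (tensorGrade K d).comap b.coprod.toLinearMap := by
    refine Submodule.span_le.2 ?_
    rintro _ ⟨l, rfl, rfl⟩
    exact b.coprod_prod_mem l
  exact h hx

end LieBasis

theorem counit_lieEval_of_ne {w : FreeMagma (PTree Unit)} (hw : w ≠ .of (bullet ())) :
    counit K (SymmetricAlgebra.ι K _ (lieEval K w)) = 0 := by
  rw [counit_ι, bulletCoeff_lieEval_of_ne hw]

theorem counit_symGrade {d : ℕ} (hd : d ≠ 0) {x : SLie K} (hx : x ∈ symGrade K d) :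
    counit K x = 0 := by
  have h : symGrade K d ≤ LinearMap.ker (counit K).toLinearMap := by
    refine Submodule.span_le.2 ?_
    rintro _ ⟨l, hl, rfl⟩
    obtain ⟨w, hw, hw'⟩ : ∃ w ∈ l, monDegree w ≠ 0 := by
      by_contra! h
      exact hd (hl ▸ List.sum_eq_zero (by simpa using h))
    rw [SetLike.mem_coe, LinearMap.mem_ker, AlgHom.toLinearMap_apply, map_list_prod,
      List.map_map]
    refine List.prod_eq_zero (List.mem_map.2 ⟨w, hw, counit_lieEval_of_ne ?_⟩)
    rintro rfl
    exact hw' rfl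
  exact h hx

end Grading

end PostLie

theorem mainTheorem5 (K : Type*) [Field K] [CharZero K] {ι : Type*} (b : PostLie.LieBasis K ι) :
    -- the sums that define the coproduct are finite
    (∀ i, {c : b.Term | b.coeff i c ≠ 0}.Finite) ∧
    -- values of the counit on Lie monomials
    PostLie.counit K (SymmetricAlgebra.ι K _
        (PostLie.lieEval K (FreeMagma.of (PostLie.bullet ())))) = 1 ∧
    (∀ w, w ≠ FreeMagma.of (PostLie.bullet ()) →
      PostLie.counit K (SymmetricAlgebra.ι K _ (PostLie.lieEval K w)) = 0) ∧
    -- the coproduct and the counit form a coassociative counital coalgebra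
    (∃ C : Coalgebra K (PostLie.SLie K),
      C.comul = b.coprod.toLinearMap ∧ C.counit = (PostLie.counit K).toLinearMap) ∧
    -- which is compatible with the symmetric product and its unit
    (∀ x y, b.coprod (x * y) = b.coprod x * b.coprod y) ∧ b.coprod 1 = 1 ⊗ₜ[K] 1 ∧
    (∀ x y, PostLie.counit K (x * y) = PostLie.counit K x * PostLie.counit K y) ∧
    PostLie.counit K 1 = 1 ∧
    -- the degree is additive under operadic composition
    (∀ (d : ℕ) (e : Fin (d + 1) → ℕ) (x : ∀ a, PostLie.LiePT K (Fin (e a + 1)))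
      (y : PostLie.LiePT K (Fin (d + 1))),
      (∀ a, x a ∈ PostLie.LabelledLie K (e a + 1)) → y ∈ PostLie.LabelledLie K (d + 1) →
      PostLie.unlabel K (PostLie.operadComp K x y) ∈ PostLie.lieGrade K (∑ a, e a + d)) ∧
    -- the degree is a grading of the bialgebra
    DirectSum.IsInternal (PostLie.symGrade K) ∧
    SetLike.GradedMonoid (PostLie.symGrade K) ∧
    (∀ d, ∀ x ∈ PostLie.symGrade K d, b.coprod x ∈ PostLie.tensorGrade K d) ∧
    (∀ d, d ≠ 0 → ∀ x ∈ PostLie.symGrade K d, PostLie.counit K x = 0) := by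
  refine ⟨b.finite_coeff_ne_zero, ?_, fun w hw => PostLie.counit_lieEval_of_ne hw, ?_,
    map_mul _, ?_, map_mul _, map_one _, ?_, PostLie.symGrade_isInternal,
    PostLie.symGrade_gradedMonoid, fun d x hx => b.coprod_mem_tensorGrade hx,
    fun d hd x hx => PostLie.counit_symGrade hd hx⟩
  · rw [PostLie.counit_ι, PostLie.bulletCoeff_bullet]
  · exact ⟨{
      comul := b.coprod.toLinearMap
      counit := (PostLie.counit K).toLinearMap
      coassoc := LinearMap.ext b.assoc_rTensor_coprod
      rTensor_counit_comp_comul := LinearMap.ext b.rTensor_counit_coprod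
      lTensor_counit_comp_comul := LinearMap.ext b.lTensor_counit_coprod }, rfl, rfl⟩
  · rw [map_one, Algebra.TensorProduct.one_def]
  · exact fun d e x y hx hy => PostLie.unlabel_operadComp_mem b hx hy
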